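/- Let $n\ge 1$. Let $\mathbf C\langle X_1,\dots,X_n\rangle$ be the free unital $*$-algebra on self-adjoint indeterminates $X_1,\dots,X_n$. Let $\mathcal S_c^n$ be the set of linear maps $\tau:\mathbf C\langle X_1,\dots,X_n\rangle\to\mathbf C$ such that $\tau(P^*)=\overline{\tau(P)}$, $\tau(P^*P)\ge 0$, $\tau(PQ)=\tau(QP)$, $\tau(1)=1$ and such that for every $P$ there is $R_P>0$ with $\tau((P^*P)^k)\le R_P^{2k}$ for all $k\ge 0$. For $R\ge 0$ let $\mathcal S_R^n$ be the set of $\tau\in\mathcal S_c^n$ with $\tau(X_i^{2k})\le R^{2k}$ for all $i$ and $k\ge 0$, and put $\mathcal R(\tau)=\inf\{R\ge 0:\tau\in\mathcal S_R^n\}$. For $R\ge 0$, $\epsilon>0$, $K\in\mathbf N$ and $\tau\in\mathcal S_c^n$, let $V^R_{\epsilon,K}(\tau)$ be the set of $\sigma\in\mathcal S_R^n$ with $|\tau(m)-\sigma(m)|<\epsilon$ for all monomials $m$ of degree less than $K$. Let $H_N$ be the space of Hermitian $N\times N$ matrices, with the Lebesgue measure of the Euclidean structure $\langle A,B\rangle=\mathrm{Tr}(AB)$,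 and let $H_N^R$ be the set of $A\in H_N$ of operator norm at most $R$. For a Borel probability measure $\mu$ on $(H_N)^n$ put $\mathrm{Ent}(\mu)=-\int f\log f$ if $\mu$ has density $f$ with respect to the product Lebesgue measure and $\log f\in L^1(\mu)$, and $\mathrm{Ent}(\mu)=-\infty$ otherwise; its barycenter is $\tau_\mu(P)=\int\frac1N\mathrm{Tr}(P(M_1,\dots,M_n))\,d\mu$. Let $\rho^R_{N,K}(\sigma)\in[-\infty,\infty]$ be the supremum of $\mathrm{Ent}(\mu)$ over the Borel probability measures $\mu$ carried by $(H_N^R)^n$ with $\tau_\mu(m)=\sigma(m)$ for all monomials $m$ of degree less than $K$ (with $\sup\emptyset=-\infty$). Define $$\tilde{\underline\chi}_R(\tau)=\lim_{K\to\infty,\,\epsilon\to0^+}\ \liminf_{N\to\infty}\Big(\frac1{N^2}\sup_{\sigma\in V^R_{\epsilon,K}(\tau)}\rho^R_{N,K}(\sigma)+\frac n2\log N\Big),$$ and define $\tilde\chi_R(\tau)$ in the same way with $\limsup_{N\to\infty}$ and, for a non-principal ultrafilter $\omega$ on $\mathbf N$, $\tilde\chi^\omega_R(\tau)$ with $\lim_{N\to\omega}$.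 Finally put $\tilde{\underline\chi}(\tau)=\sup_{R\ge\mathcal R(\tau)}\tilde{\underline\chi}_R(\tau)$, and likewise $\tilde\chi(\tau)$ and $\tilde\chi^\omega(\tau)$. All these quantities take values in $[-\infty,\infty]$. **Proposition.** Let $\tau\in\mathcal S_c^n$. For all real $T>R>\mathcal R(\tau)$, $$\tilde{\underline\chi}_T(\tau)=\tilde{\underline\chi}_R(\tau)=\tilde{\underline\chi}(\tau),\qquad \tilde\chi_T(\tau)=\tilde\chi_R(\tau)=\tilde\chi(\tau),$$ and, for every non-principal ultrafilter $\omega$ on $\mathbf N$, $\tilde\chi^\omega_T(\tau)=\tilde\chi^\omega_R(\tau)=\tilde\chi^\omega(\tau)$. -/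

import Mathlib

open Filter Topology MeasureTheory

noncomputable section

/-! ### Noncommutative polynomials -/

/-- `ℂ⟨X₁, …, Xₙ⟩`: noncommutative polynomials, i.e. complex linear combinations of words
in the letters `X₁, …, Xₙ`. -/
abbrev NCPoly (n : ℕ) : Type := MonoidAlgebra ℂ (FreeMonoid (Fin n))

namespace NCPoly

/-- The monomial `X_{i₁} ⋯ X_{iₖ}` attached to a word. Its degree is the length of the word. -/
def mono {n : ℕ} (w : FreeMonoid (Fin n)) : NCPoly n := MonoidAlgebra.of ℂ (FreeMonoid (Fin n)) w

/-- The indeterminate `Xᵢ`. -/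
def X {n : ℕ} (i : Fin n) : NCPoly n := mono (FreeMonoid.of i)

/-- The `*`-operation: the conjugate-linear map with
`(X_{i₁} ⋯ X_{iₖ})* = X_{iₖ} ⋯ X_{i₁}` (the star of the free monoid is word reversal). -/
def adj {n : ℕ} (P : NCPoly n) : NCPoly n :=
  Finsupp.sum P.coeff fun w c => MonoidAlgebra.single (star w) (star c)

/-- Evaluation `P ↦ P(a₁, …, aₙ)` in a complex algebra. -/
def evalAt {n : ℕ} {A : Type*} [Ring A] [Algebra ℂ A] (a : Fin n → A) : NCPoly n →ₐ[ℂ] A :=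
  MonoidAlgebra.lift ℂ A (FreeMonoid (Fin n)) (FreeMonoid.lift a)

end NCPoly

open NCPoly

/-! ### Trace states -/

/-- `τ((P* P)^k) ≤ r^{2k}` for all `k ≥ 0`. -/
def MomentBound {n : ℕ} (τ : NCPoly n →ₗ[ℂ] ℂ) (P : NCPoly n) (r : ℝ) : Prop :=
  ∀ k : ℕ, (τ ((adj P * P) ^ k)).re ≤ r ^ (2 * k)

/-- `S_c^n`: positive, tracial, `*`-linear, unital functionals on `ℂ⟨X₁, …, Xₙ⟩` for which every
polynomial satisfies a moment bound. -/
structure IsTraceState {n : ℕ} (τ : NCPoly n →ₗ[ℂ] ℂ) : Prop where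
  map_adj : ∀ P, τ (adj P) = star (τ P)
  nonneg : ∀ P, 0 ≤ (τ (adj P * P)).re ∧ (τ (adj P * P)).im = 0
  tracial : ∀ P Q, τ (P * Q) = τ (Q * P)
  map_one : τ 1 = 1
  bounded : ∀ P, ∃ r : ℝ, 0 < r ∧ MomentBound τ P r

/-- `S_R^n`: the trace states for which the constants of `X₁, …, Xₙ` can be taken at most `R`. -/
def traceStates (n : ℕ) (R : ℝ) : Set (NCPoly n →ₗ[ℂ] ℂ) :=
  {τ | IsTraceState τ ∧ 0 ≤ R ∧ ∀ i, MomentBound τ (X i) R}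

/-- `𝓡(τ) = inf {R | τ ∈ S_R^n}`. -/
def stateRadius {n : ℕ} (τ : NCPoly n →ₗ[ℂ] ℂ) : ℝ := sInf {R : ℝ | τ ∈ traceStates n R}

/-- `V_{ε,K}(τ)`: the states `σ ∈ S_R^n` with `|τ(m) - σ(m)| < ε` for all monomials `m` of degree
less than `K`. -/
def stateNhd {n : ℕ} (R ε : ℝ) (K : ℕ) (τ : NCPoly n →ₗ[ℂ] ℂ) : Set (NCPoly n →ₗ[ℂ] ℂ) :=
  {σ | σ ∈ traceStates n R ∧
    ∀ w : FreeMonoid (Fin n), w.length < K → ‖τ (mono w) - σ (mono w)‖ < ε}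

/-! ### Hermitian matrices and their Lebesgue measure -/

/-- The real vector space of Hermitian `N × N` matrices. -/
abbrev Herm (N : ℕ) : Type := selfAdjoint (Matrix (Fin N) (Fin N) ℂ)

instance instMeasurableSpaceHerm (N : ℕ) : MeasurableSpace (Herm N) := borel (Herm N)

instance instBorelSpaceHerm (N : ℕ) : BorelSpace (Herm N) := ⟨rfl⟩

/-- The linear isometry `ℝ^{N²} → H_N` for the Euclidean norm on `ℝ^{N²}` and the norm
`Tr(A²)^{1/2}` on `H_N`: diagonal coordinates are the diagonal entries; for `i < j` the
coordinates `(i, j)` and `(j, i)` are `√2` times the real and imaginary part of the `(i, j)`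
entry. -/
def hermOfCoord (N : ℕ) (x : Fin N × Fin N → ℝ) : Herm N :=
  ⟨Matrix.of fun i j =>
      if i = j then (x (i, i) : ℂ)
      else if i < j then ((x (i, j) : ℂ) + x (j, i) * Complex.I) / (√2 : ℝ)
      else ((x (j, i) : ℂ) - x (i, j) * Complex.I) / (√2 : ℝ), by
    rw [selfAdjoint.mem_iff, Matrix.star_eq_conjTranspose]
    ext i j
    rcases lt_trichotomy i j with h | h | h
    · simp [h.ne, h.ne', h, h.not_gt, sub_eq_add_neg]
    · subst h; simp
    · simp [h.ne, h.ne', h, h.not_gt, sub_eq_add_neg]⟩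

theorem continuous_hermOfCoord (N : ℕ) : Continuous (hermOfCoord N) := by
  refine Continuous.subtype_mk (continuous_matrix fun i j => ?_) _
  simp only [Matrix.of_apply]
  split_ifs <;> fun_prop

theorem trace_hermOfCoord_sq (N : ℕ) (x : Fin N × Fin N → ℝ) :
    ((hermOfCoord N x : Matrix (Fin N) (Fin N) ℂ) * (hermOfCoord N x : Matrix _ _ ℂ)).trace = ∑ p, (x p : ℂ) ^ 2 := by
  have h2 : ((√2:ℝ):ℂ)^2 = 2 := by rw [← Complex.ofReal_pow]; norm_num
  have h2' : ((√2:ℝ):ℂ) ≠ 0 := by simp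
  have key : ∀ i j : Fin N, (hermOfCoord N x : Matrix (Fin N) (Fin N) ℂ) i j * (hermOfCoord N x : Matrix _ _ ℂ) j i = ((x (i,j):ℂ)^2 + (x (j,i):ℂ)^2)/2 := by
    intro i j
    simp only [hermOfCoord, Matrix.of_apply]
    rcases lt_trichotomy i j with h | h | h
    · simp only [h.ne, h.ne', h, h.not_gt, if_true, if_false]
      field_simp
      rw [h2]; ring_nf; simp
    · subst h; simp; ring
    · simp only [h.ne, h.ne', h, h.not_gt, if_true, if_false]
      field_simp
      rw [h2]; ring_nf; simp
  simp only [Matrix.trace, Matrix.diag, Matrix.mul_apply, key, Fintype.sum_prod_type]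
  simp only [add_div, Finset.sum_add_distrib]
  rw [Finset.sum_comm (f := fun i j => (x (j,i):ℂ)^2/2)]
  rw [← Finset.sum_add_distrib]; simp only [← Finset.sum_add_distrib]; 
  simp

/-- Lebesgue measure on `H_N`, for the Euclidean structure `⟨A, B⟩ = Tr(AB)`. -/
def hermLebesgue (N : ℕ) : Measure (Herm N) := Measure.map (hermOfCoord N) volume

/-- Lebesgue measure on `(H_N)^n`. -/
def hermLebesgueTuple (n N : ℕ) : Measure (Fin n → Herm N) := Measure.pi fun _ => hermLebesgue N

/-- The product of operator norm balls `(H_N^R)^n`. -/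
def hermBall (n N : ℕ) (R : ℝ) : Set (Fin n → Herm N) :=
  {M | ∀ i, ‖Matrix.toEuclideanCLM (𝕜 := ℂ) (n := Fin N) (M i : Matrix (Fin N) (Fin N) ℂ)‖ ≤ R}

/-- `P[(H_N^R)^n]`: Borel probability measures on `(H_N)^n` carried by `(H_N^R)^n`. -/
def ballProb (n N : ℕ) (R : ℝ) : Set (Measure (Fin n → Herm N)) :=
  {μ | IsProbabilityMeasure μ ∧ μ (hermBall n N R)ᶜ = 0}

/-- `τ_{M₁, …, Mₙ}(P) = (1/N) Tr(P(M₁, …, Mₙ))`. -/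
def matrixState {n N : ℕ} (M : Fin n → Herm N) (P : NCPoly n) : ℂ :=
  (1 / (N : ℂ)) * Matrix.trace (evalAt (fun i => (M i : Matrix (Fin N) (Fin N) ℂ)) P)

/-- The barycenter `τ_μ(P) = ∫ (1/N) Tr(P(M₁, …, Mₙ)) dμ(M₁, …, Mₙ)`. -/
def barycenter {n N : ℕ} (μ : Measure (Fin n → Herm N)) (P : NCPoly n) : ℂ :=
  ∫ M, matrixState M P ∂μ

/-! ### Entropies -/

open Classical in
/-- `Ent(μ) = -∫ f log f dλ` if `μ = f λ` and `log f ∈ L¹(μ)`, and `-∞` otherwise. Here `λ` is the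
reference (Lebesgue) measure. -/
def classicalEnt {Ω : Type*} [MeasurableSpace Ω] (lam μ : Measure Ω) : EReal :=
  if μ ≪ lam ∧ Integrable (fun x => Real.log (μ.rnDeriv lam x).toReal) μ then
    ((-∫ x, (μ.rnDeriv lam x).toReal * Real.log (μ.rnDeriv lam x).toReal ∂lam : ℝ) : EReal)
  else ⊥

/-- `ρ_{N,K}(σ)`: the supremum of the entropies of the probability measures on `(H_N^R)^n` whose
barycenter coincides with `σ` on monomials of degree less than `K` (`-∞` if there are none). -/
def rho {n : ℕ} (R : ℝ) (N K : ℕ) (σ : NCPoly n →ₗ[ℂ] ℂ) : EReal :=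
  ⨆ μ ∈ {μ ∈ ballProb n N R |
      ∀ w : FreeMonoid (Fin n), w.length < K → barycenter μ (mono w) = σ (mono w)},
    classicalEnt (hermLebesgueTuple n N) μ

/-- `(1/N²) sup_{σ ∈ V_{ε,K}(τ)} ρ_{N,K}(σ) + (n/2) log N`. -/
def normalizedRho {n : ℕ} (R : ℝ) (τ : NCPoly n →ₗ[ℂ] ℂ) (K : ℕ) (ε : ℝ) (N : ℕ) : EReal :=
  ((1 / (N : ℝ) ^ 2 : ℝ) : EReal) * (⨆ σ ∈ stateNhd R ε K τ, rho R N K σ) +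
    (((n : ℝ) / 2 * Real.log N : ℝ) : EReal)

/-- The limit of `F K ε` as `K → ∞` and `ε → 0⁺`. -/
def cutoffLim (F : ℕ → ℝ → EReal) : EReal :=
  limUnder (atTop ×ˢ 𝓝[>] (0 : ℝ)) fun p : ℕ × ℝ => F p.1 p.2

/-- The concavified free entropy with cutoff `R`, `liminf` variant. -/
def chiLiminf {n : ℕ} (R : ℝ) (τ : NCPoly n →ₗ[ℂ] ℂ) : EReal :=
  cutoffLim fun K ε => liminf (normalizedRho R τ K ε) atTop

/-- The concavified free entropy with cutoff `R`, `limsup` variant. -/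
def chiLimsup {n : ℕ} (R : ℝ) (τ : NCPoly n →ₗ[ℂ] ℂ) : EReal :=
  cutoffLim fun K ε => limsup (normalizedRho R τ K ε) atTop

/-- The concavified free entropy with cutoff `R`, variant with the limit along an ultrafilter. -/
def chiUltra {n : ℕ} (ω : Ultrafilter ℕ) (R : ℝ) (τ : NCPoly n →ₗ[ℂ] ℂ) : EReal :=
  cutoffLim fun K ε => limUnder (ω : Filter ℕ) (normalizedRho R τ K ε)

/-- The concavified free entropy, `liminf` variant: supremum over all cutoffs `R ≥ 𝓡(τ)`. -/
def chiLiminfSup {n : ℕ} (τ : NCPoly n →ₗ[ℂ] ℂ) : EReal :=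
  ⨆ R : ℝ, ⨆ _ : stateRadius τ ≤ R, chiLiminf R τ

/-- The concavified free entropy, `limsup` variant: supremum over all cutoffs `R ≥ 𝓡(τ)`. -/
def chiLimsupSup {n : ℕ} (τ : NCPoly n →ₗ[ℂ] ℂ) : EReal :=
  ⨆ R : ℝ, ⨆ _ : stateRadius τ ≤ R, chiLimsup R τ

/-- The concavified free entropy, ultrafilter variant: supremum over all cutoffs `R ≥ 𝓡(τ)`. -/
def chiUltraSup {n : ℕ} (ω : Ultrafilter ℕ) (τ : NCPoly n →ₗ[ℂ] ℂ) : EReal :=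
  ⨆ R : ℝ, ⨆ _ : stateRadius τ ≤ R, chiUltra ω R τ

/-! ### The limits in these definitions exist -/

/-- Nonincreasing in `K` and nondecreasing in `ε > 0`: the limit exists and is the infimum. -/
theorem tendsto_cutoffLim {F : ℕ → ℝ → EReal}
    (hF : ∀ K K' : ℕ, ∀ ε ε' : ℝ, K ≤ K' → 0 < ε' → ε' ≤ ε → F K' ε' ≤ F K ε) :
    Tendsto (fun p : ℕ × ℝ => F p.1 p.2) (atTop ×ˢ 𝓝[>] (0 : ℝ)) (𝓝 (cutoffLim F)) ∧
      cutoffLim F = ⨅ (K : ℕ) (ε : ℝ) (_ : 0 < ε), F K ε := by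
  have key : Tendsto (fun p : ℕ × ℝ => F p.1 p.2) (atTop ×ˢ 𝓝[>] (0 : ℝ))
      (𝓝 (⨅ (K : ℕ) (ε : ℝ) (_ : 0 < ε), F K ε)) := by
    refine tendsto_order.2 ⟨fun a ha => ?_, fun a ha => ?_⟩
    · have : ∀ᶠ p : ℕ × ℝ in atTop ×ˢ 𝓝[>] (0 : ℝ), 0 < p.2 :=
        tendsto_snd.eventually (eventually_mem_nhdsWithin)
      filter_upwards [this] with p hp
      exact ha.trans_le ((iInf_le _ p.1).trans (iInf₂_le p.2 hp))
    · simp only [iInf_lt_iff] at ha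
      obtain ⟨K, ε, hε, h⟩ := ha
      have h1 : ∀ᶠ p : ℕ × ℝ in atTop ×ˢ 𝓝[>] (0 : ℝ), K ≤ p.1 :=
        tendsto_fst.eventually (eventually_ge_atTop K)
      have h2 : ∀ᶠ p : ℕ × ℝ in atTop ×ˢ 𝓝[>] (0 : ℝ), p.2 ∈ Set.Ioc 0 ε :=
        tendsto_snd.eventually (Ioc_mem_nhdsGT hε)
      filter_upwards [h1, h2] with p hp hq
      exact (hF K p.1 ε p.2 hp hq.1 hq.2).trans_lt h
  have e : cutoffLim F = ⨅ (K : ℕ) (ε : ℝ) (_ : 0 < ε), F K ε := key.limUnder_eq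
  exact ⟨e ▸ key, e⟩

theorem normalizedRho_mono {n : ℕ} (R : ℝ) (τ : NCPoly n →ₗ[ℂ] ℂ) (N : ℕ) {K K' : ℕ} {ε ε' : ℝ}
    (hK : K ≤ K') (hε : ε' ≤ ε) : normalizedRho R τ K' ε' N ≤ normalizedRho R τ K ε N := by
  unfold normalizedRho
  have h0 : (0 : EReal) ≤ ((1 / (N : ℝ) ^ 2 : ℝ) : EReal) :=
    EReal.coe_nonneg.2 (by positivity)
  refine add_le_add_left (mul_le_mul_of_nonneg_left ?_ h0) _
  refine iSup₂_le fun σ hσ => ?_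
  refine le_trans ?_ (le_iSup₂_of_le (f := fun σ _ => rho R N K σ) σ
    ⟨hσ.1, fun w hw => (hσ.2 w (hw.trans_le hK)).trans_le hε⟩ le_rfl)
  exact biSup_mono fun μ hμ => ⟨hμ.1, fun w hw => hμ.2 w (hw.trans_le hK)⟩

theorem tendsto_ultrafilter (ω : Ultrafilter ℕ) (f : ℕ → EReal) :
    Tendsto f (ω : Filter ℕ) (𝓝 (limUnder (ω : Filter ℕ) f)) := by
  obtain ⟨a, -, ha⟩ := isCompact_univ.ultrafilter_le_nhds (ω.map f) (by simp)
  exact tendsto_nhds_limUnder ⟨a, ha⟩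

theorem chiLiminf_eq_iInf {n : ℕ} (R : ℝ) (τ : NCPoly n →ₗ[ℂ] ℂ) :
    chiLiminf R τ =
      ⨅ (K : ℕ) (ε : ℝ) (_ : 0 < ε), liminf (normalizedRho R τ K ε) atTop :=
  (tendsto_cutoffLim fun _ _ _ _ hK _ hε =>
    liminf_le_liminf (Eventually.of_forall fun N => normalizedRho_mono R τ N hK hε)).2

theorem chiLimsup_eq_iInf {n : ℕ} (R : ℝ) (τ : NCPoly n →ₗ[ℂ] ℂ) :
    chiLimsup R τ =
      ⨅ (K : ℕ) (ε : ℝ) (_ : 0 < ε), limsup (normalizedRho R τ K ε) atTop :=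
  (tendsto_cutoffLim fun _ _ _ _ hK _ hε =>
    limsup_le_limsup (Eventually.of_forall fun N => normalizedRho_mono R τ N hK hε)).2

theorem chiUltra_eq_iInf {n : ℕ} (ω : Ultrafilter ℕ) (R : ℝ) (τ : NCPoly n →ₗ[ℂ] ℂ) :
    chiUltra ω R τ =
      ⨅ (K : ℕ) (ε : ℝ) (_ : 0 < ε), limUnder (ω : Filter ℕ) (normalizedRho R τ K ε) :=
  (tendsto_cutoffLim fun _ _ _ _ hK _ hε =>
    le_of_tendsto_of_tendsto' (tendsto_ultrafilter ω _) (tendsto_ultrafilter ω _)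
      fun N => normalizedRho_mono R τ N hK hε).2

end

noncomputable section

open NCPoly
open scoped Matrix.Norms.L2Operator
open Polynomial (aeval)

/-! Enlarging the cutoff only admits more states and more measures, so each entropy is nondecreasing
in it; the content is the inequality from `T` down to `R`. Take `R₀ < R₁ < R` with `τ` in
`traceStates n R₀`, and let `μ` live on the ball of radius `T` with moments close to those of `τ`.
Push `μ` forward by applying to each matrix a polynomial `p` that maps `[-T, T]` into `[-R, R]`,
with `p' ≥ c > 0` there and `p'` within `η` of `1` on `[-R₁, R₁]` (`exists_compressing_polynomial`).

The Jacobian is the product of the divided differences of `p` over ordered pairs of eigenvalues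
(`exists_hasFDerivAt_polyHerm`). Its logarithm loses at most `2η` for a pair inside `[-R₁, R₁]` and
at most `-log c` for any other pair. Eigenvalues outside are rare on average: `(x / R₁)^(2m)` is at
least `1` there, and its mean is a moment of `μ`, close to at most `(R₀ / R₁)^(2m)`, hence small for
large `m`. So the entropy drops by at most `N²δ` (`Compresses.classicalEnt_le_map_add`), and low
moments barely move because `p(M) - M` is small in normalized trace norm on average
(`Compresses.norm_barycenter_map_sub_le`). The order of choices matters: `c` depends only on `R₁, R,
T`, so `η` and `m` can be adapted to `log c`.

The barycenter of the image measure is itself a state in `traceStates n R`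
(`barycenterState_mem_traceStates`), so it competes in the supremum for the cutoff `R`. The
constants are uniform in `N` after division by `N²`; `exists_normalizedRho_le` therefore passes to
any monotone limit compatible with adding real constants, and `cutoff_independence` treats the three
variants at once. -/

/-! ### Divided differences of polynomials -/

/-- The divided difference `(p(x) - p(y)) / (x - y)`, equal to `p'(x)` on the diagonal. -/
def divDiff (p : Polynomial ℝ) (x y : ℝ) : ℝ :=
  if x = y then p.derivative.eval x else (p.eval x - p.eval y) / (x - y)

theorem divDiff_comm (p : Polynomial ℝ) (x y : ℝ) : divDiff p x y = divDiff p y x := by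
  unfold divDiff
  by_cases h : x = y
  · simp [h]
  · rw [if_neg h, if_neg (Ne.symm h), ← neg_sub, ← neg_sub y x, neg_div_neg_eq]

theorem divDiff_C (a x y : ℝ) : divDiff (Polynomial.C a) x y = 0 := by simp [divDiff]

theorem divDiff_add (p q : Polynomial ℝ) (x y : ℝ) :
    divDiff (p + q) x y = divDiff p x y + divDiff q x y := by
  unfold divDiff
  split_ifs
  · simp
  · simp; ring

/-- Leibniz rule, the scalar shadow of differentiating `B ↦ p(B) B`; it drives the induction in
`exists_hasFDerivAt_aeval`. -/
theorem divDiff_mul_X (p : Polynomial ℝ) (x y : ℝ) :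
    divDiff (p * Polynomial.X) x y = divDiff p x y * y + p.eval x := by
  unfold divDiff
  split_ifs with h
  · simp [h]
  · have := sub_ne_zero.2 h
    simp only [Polynomial.eval_mul, Polynomial.eval_X]
    field_simp
    ring

/-- Mean value theorem: every bound on `p'` over an interval becomes a bound on divided differences.
-/
theorem exists_divDiff_eq (p : Polynomial ℝ) {s : Set ℝ} (hs : s.OrdConnected) {x y : ℝ}
    (hx : x ∈ s) (hy : y ∈ s) : ∃ z ∈ s, divDiff p x y = p.derivative.eval z := by
  wlog h : x ≤ y generalizing x y
  · rw [divDiff_comm]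
    exact this hy hx (le_of_not_ge h)
  rcases h.eq_or_lt with rfl | h
  · exact ⟨x, hx, by simp [divDiff]⟩
  · obtain ⟨z, hz, e⟩ := exists_hasDerivAt_eq_slope (fun t => p.eval t)
      (fun t => p.derivative.eval t) h p.continuous.continuousOn fun t _ => p.hasDerivAt t
    refine ⟨z, hs.out hx hy (Set.Ioo_subset_Icc_self hz), ?_⟩
    rw [divDiff_comm, divDiff, if_neg h.ne', e]

/-! ### Hermitian matrices as a real normed space -/

instance finiteDimensional_herm (N : ℕ) : FiniteDimensional ℝ (Herm N) :=
  inferInstanceAs (FiniteDimensional ℝ (selfAdjoint.submodule ℝ (Matrix (Fin N) (Fin N) ℂ)))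

instance secondCountableTopology_herm (N : ℕ) : SecondCountableTopology (Herm N) := inferInstance

instance polishSpace_herm (N : ℕ) : PolishSpace (Herm N) := inferInstance

instance borelSpace_hermTuple (n N : ℕ) : BorelSpace (Fin n → Herm N) := Pi.borelSpace

instance polishSpace_hermTuple (n N : ℕ) : PolishSpace (Fin n → Herm N) := inferInstance

theorem hermOfCoord_surjective (N : ℕ) : Function.Surjective (hermOfCoord N) := by
  intro A
  have hA : ∀ i j, star ((A : Matrix (Fin N) (Fin N) ℂ) j i) = (A : Matrix (Fin N) (Fin N) ℂ) i j :=
    fun i j => congrFun (congrFun A.2 i) j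
  have h2 : ((√2 : ℝ) : ℂ) ≠ 0 := by simp
  refine ⟨fun p => if p.1 = p.2 then ((A : Matrix (Fin N) (Fin N) ℂ) p.1 p.2).re
    else if p.1 < p.2 then √2 * ((A : Matrix (Fin N) (Fin N) ℂ) p.1 p.2).re
    else √2 * ((A : Matrix (Fin N) (Fin N) ℂ) p.2 p.1).im, ?_⟩
  ext i j
  simp only [hermOfCoord, Matrix.of_apply]
  rcases lt_trichotomy i j with h | h | h
  · simp only [h.ne, h.ne', h, h.not_gt, if_true, if_false]
    push_cast
    field_simp
    exact Complex.re_add_im _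
  · subst h
    have := hA i i
    simp only [if_true]
    exact Complex.conj_eq_iff_re.1 this
  · simp only [h.ne, h.ne', h, h.not_gt, if_true, if_false]
    push_cast
    field_simp
    rw [← hA i j]
    apply Complex.ext <;> simp

/-- The coordinates of Hermitian matrices as a linear equivalence. -/
def hermCoordEquiv (N : ℕ) : (Fin N × Fin N → ℝ) ≃ₗ[ℝ] Herm N :=
  LinearEquiv.ofBijective
    { toFun := hermOfCoord N
      map_add' := fun x y => by
        ext i j
        simp only [hermOfCoord, Matrix.of_apply, AddSubgroup.coe_add, Matrix.add_apply,
          Pi.add_apply]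
        split_ifs <;> push_cast <;> ring
      map_smul' := fun c x => by
        ext i j
        simp only [hermOfCoord, Matrix.of_apply, selfAdjoint.val_smul, Matrix.smul_apply,
          Pi.smul_apply, RingHom.id_apply, smul_eq_mul, Complex.real_smul]
        split_ifs <;> push_cast <;> ring }
    ⟨by
      -- The coordinates are isometric: `Tr(A²)` is their sum of squares, so the kernel is trivial.
      rw [← LinearMap.ker_eq_bot, LinearMap.ker_eq_bot']
      intro x hx
      have h := trace_hermOfCoord_sq N x
      rw [show hermOfCoord N x = 0 from hx] at h
      have h0 : ∑ p, x p ^ 2 = 0 := by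
        have : (((∑ p, x p ^ 2 : ℝ)) : ℂ) = 0 := by push_cast; rw [← h]; simp
        exact_mod_cast this
      ext p
      have := (Finset.sum_eq_zero_iff_of_nonneg fun p _ => sq_nonneg (x p)).1 h0 p
        (Finset.mem_univ p)
      simpa using this, hermOfCoord_surjective N⟩

/-- Makes the change of variables formula for additive Haar measures available. -/
instance isAddHaarMeasure_hermLebesgue (N : ℕ) : (hermLebesgue N).IsAddHaarMeasure :=
  (hermCoordEquiv N).toContinuousLinearEquiv.isAddHaarMeasure_map volume

instance isAddHaarMeasure_hermLebesgueTuple (n N : ℕ) :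
    (hermLebesgueTuple n N).IsAddHaarMeasure := by
  unfold hermLebesgueTuple
  infer_instance

/-! ### Polynomial functions of Hermitian matrices -/

theorem Herm.exists_diagonalization {N : ℕ} (A : Herm N) :
    ∃ (U : unitary (Matrix (Fin N) (Fin N) ℂ)) (l : Fin N → ℝ),
      (A : Matrix (Fin N) (Fin N) ℂ) =
        U * Matrix.diagonal (fun i => (l i : ℂ)) * star (U : Matrix (Fin N) (Fin N) ℂ) := by
  have hA : (A : Matrix (Fin N) (Fin N) ℂ).IsHermitian := A.2
  exact ⟨hA.eigenvectorUnitary, hA.eigenvalues, hA.spectral_theorem⟩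

theorem norm_unitary_conj_diagonal {N : ℕ} (U : unitary (Matrix (Fin N) (Fin N) ℂ))
    (l : Fin N → ℝ) :
    ‖(U : Matrix (Fin N) (Fin N) ℂ) * Matrix.diagonal (fun i => (l i : ℂ)) * star
      (U : Matrix (Fin N) (Fin N) ℂ)‖ = ‖l‖ := by
  rw [← Unitary.coe_star, CStarRing.norm_mul_coe_unitary, CStarRing.norm_coe_unitary_mul,
    Matrix.l2_opNorm_diagonal, Pi.norm_def, Pi.norm_def]
  simp

theorem aeval_unitary_conj_diagonal {N : ℕ} (U : unitary (Matrix (Fin N) (Fin N) ℂ))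
    (l : Fin N → ℝ) (p : Polynomial ℝ) :
    aeval ((U : Matrix (Fin N) (Fin N) ℂ) * Matrix.diagonal (fun i => (l i : ℂ)) * star
      (U : Matrix (Fin N) (Fin N) ℂ)) p =
      U * Matrix.diagonal (fun i => ((p.eval (l i) : ℝ) : ℂ)) * star
        (U : Matrix (Fin N) (Fin N) ℂ) := by
  have hU : (star U : Matrix (Fin N) (Fin N) ℂ) * U = 1 := Unitary.coe_star_mul_self U
  have hU' : (U : Matrix (Fin N) (Fin N) ℂ) * star (U : Matrix (Fin N) (Fin N) ℂ) = 1 :=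
    Unitary.coe_mul_star_self U
  induction p using Polynomial.induction_on with
  | C a =>
    have : (Matrix.diagonal fun _ : Fin N => (a : ℂ)) = (a : ℂ) • 1 := by
      rw [← Matrix.diagonal_one, ← Matrix.diagonal_smul]; congr; ext i; simp
    simp only [Polynomial.aeval_C, Polynomial.eval_C, this]
    rw [mul_smul_comm, smul_mul_assoc, mul_one, hU', Algebra.algebraMap_eq_smul_one]
    ext i j; simp
  | add p q hp hq =>
    rw [map_add, hp, hq, ← add_mul, ← mul_add, Matrix.diagonal_add]
    simp
  | monomial n a h =>
    rw [pow_succ, ← mul_assoc, map_mul, h, Polynomial.aeval_X]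
    rw [show ∀ V D E : Matrix (Fin N) (Fin N) ℂ, V * D * star V * (V * E * star V) =
      V * (D * (star V * V) * E) * star V by intros; noncomm_ring, hU, mul_one,
      Matrix.diagonal_mul_diagonal]
    congr 3
    ext i
    simp

/-- The map `A ↦ p(A)` on Hermitian matrices. -/
def polyHerm {N : ℕ} (p : Polynomial ℝ) (A : Herm N) : Herm N :=
  ⟨aeval (A : Matrix (Fin N) (Fin N) ℂ) p, by
    obtain ⟨U, l, h⟩ := A.exists_diagonalization
    rw [h, aeval_unitary_conj_diagonal, selfAdjoint.mem_iff]
    simp only [star_mul, mul_assoc, Matrix.star_eq_conjTranspose,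
      Matrix.conjTranspose_conjTranspose,
      Matrix.diagonal_conjTranspose]
    congr 3
    ext i
    simp⟩

theorem coe_polyHerm {N : ℕ} (p : Polynomial ℝ) (A : Herm N) :
    (polyHerm p A : Matrix (Fin N) (Fin N) ℂ) = aeval (A : Matrix (Fin N) (Fin N) ℂ) p := rfl

/-- Daleckii–Krein formula: in an eigenbasis of `A` the derivative is entrywise multiplication by
divided differences. The induction multiplies by one more `X` and matches the two product rules. -/
theorem exists_hasFDerivAt_aeval {N : ℕ} (p : Polynomial ℝ) {A : Matrix (Fin N) (Fin N) ℂ}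
    {U : unitary (Matrix (Fin N) (Fin N) ℂ)} {l : Fin N → ℝ}
    (hA : A = U * Matrix.diagonal (fun i => (l i : ℂ)) * star (U : Matrix (Fin N) (Fin N) ℂ)) :
    ∃ D : Matrix (Fin N) (Fin N) ℂ →L[ℝ] Matrix (Fin N) (Fin N) ℂ,
      HasFDerivAt (fun B => aeval B p) D A ∧
      ∀ B i j, (star (U : Matrix (Fin N) (Fin N) ℂ) * D B * U) i j =
        (divDiff p (l i) (l j) : ℂ) * (star (U : Matrix (Fin N) (Fin N) ℂ) * B * U) i j := by
  have hU : (star U : Matrix (Fin N) (Fin N) ℂ) * U = 1 := Unitary.coe_star_mul_self U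
  induction p using Polynomial.induction_on with
  | C a =>
    exact ⟨0, by simpa using hasFDerivAt_const _ _, fun B i j => by simp [divDiff_C]⟩
  | add p q hp hq =>
    obtain ⟨D, hD, hD'⟩ := hp
    obtain ⟨E, hE, hE'⟩ := hq
    refine ⟨D + E, (hD.add hE).congr_of_eventuallyEq (Eventually.of_forall fun B => by simp),
      fun B i j => ?_⟩
    rw [divDiff_add, Complex.ofReal_add, add_mul, ← hD', ← hE']
    simp [mul_add, add_mul]
  | monomial n a h =>
    obtain ⟨D, hD, hD'⟩ := h
    set p : Polynomial ℝ := Polynomial.C a * Polynomial.X ^ n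
    have e : Polynomial.C a * Polynomial.X ^ (n + 1) = p * Polynomial.X := by
      rw [pow_succ, mul_assoc]
    rw [e]
    have h1 := hD.mul' (hasFDerivAt_id (𝕜 := ℝ) A)
    refine ⟨_, h1.congr_of_eventuallyEq (Eventually.of_forall fun B => by simp), fun B i j => ?_⟩
    have e1 : star (U : Matrix (Fin N) (Fin N) ℂ) * (D B * A) * U =
        (star (U : Matrix (Fin N) (Fin N) ℂ) * D B * U) * Matrix.diagonal (fun i => (l i : ℂ)) := by
      rw [hA, show ∀ V X E : Matrix (Fin N) (Fin N) ℂ, star V * (X * (V * E * star V)) * V =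
        star V * X * V * E * (star V * V) by intros; noncomm_ring, hU, mul_one]
    have e2 : star (U : Matrix (Fin N) (Fin N) ℂ) * (aeval A p * B) * U =
        Matrix.diagonal (fun i => ((p.eval (l i) : ℝ) : ℂ)) *
          (star (U : Matrix (Fin N) (Fin N) ℂ) * B * U) := by
      rw [hA, aeval_unitary_conj_diagonal, show ∀ V X E : Matrix (Fin N) (Fin N) ℂ,
        star V * (V * E * star V * X) * V = (star V * V) * (E * (star V * X * V)) by
          intros; noncomm_ring, hU, one_mul]
    have e3 : (aeval A p • ContinuousLinearMap.id ℝ (Matrix (Fin N) (Fin N) ℂ) +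
        MulOpposite.op (id A) • D) B = aeval A p * B + D B * A := rfl
    rw [e3, mul_add, add_mul, e1, e2, Matrix.add_apply, Matrix.mul_diagonal,
      Matrix.diagonal_mul, hD', divDiff_mul_X]
    push_cast
    ring

/-- Conjugation of Hermitian matrices by a unitary. -/
def conjHerm {N : ℕ} (U : unitary (Matrix (Fin N) (Fin N) ℂ)) : Herm N ≃ₗ[ℝ] Herm N where
  toFun A := ⟨U * A * star (U : Matrix (Fin N) (Fin N) ℂ), A.2.conjugate _⟩
  map_add' A B := by ext1; simp [mul_add, add_mul]
  map_smul' c A := by ext1; simp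
  invFun A := ⟨star (U : Matrix (Fin N) (Fin N) ℂ) * A * U, A.2.conjugate' _⟩
  left_inv A := by
    ext1
    have hU : (star U : Matrix (Fin N) (Fin N) ℂ) * U = 1 := Unitary.coe_star_mul_self U
    change star (U : Matrix (Fin N) (Fin N) ℂ) *
      (U * A * star (U : Matrix (Fin N) (Fin N) ℂ)) * U = A
    rw [show ∀ V X : Matrix (Fin N) (Fin N) ℂ, star V * (V * X * star V) * V =
      (star V * V) * X * (star V * V) by intros; noncomm_ring, hU, mul_one, one_mul]
  right_inv A := by
    ext1
    have hU : (U : Matrix (Fin N) (Fin N) ℂ) * star (U : Matrix (Fin N) (Fin N) ℂ) = 1 :=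
      Unitary.coe_mul_star_self U
    change (U : Matrix (Fin N) (Fin N) ℂ) * (star (U : Matrix (Fin N) (Fin N) ℂ) * A * U) *
      star (U : Matrix (Fin N) (Fin N) ℂ) = A
    rw [show ∀ V X : Matrix (Fin N) (Fin N) ℂ, V * (star V * X * V) * star V =
      (V * star V) * X * (V * star V) by intros; noncomm_ring, hU, mul_one, one_mul]

/-- In the Hermitian coordinates rotated by `U` the derivative is diagonal: real and imaginary parts
of the entry `(i, j)` are both scaled by the same real number. Hence one factor per ordered pair. -/
theorem exists_hasFDerivAt_polyHerm {N : ℕ} (p : Polynomial ℝ) {A : Herm N}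
    {U : unitary (Matrix (Fin N) (Fin N) ℂ)} {l : Fin N → ℝ}
    (hA : (A : Matrix (Fin N) (Fin N) ℂ) =
      U * Matrix.diagonal (fun i => (l i : ℂ)) * star (U : Matrix (Fin N) (Fin N) ℂ)) :
    ∃ D : Herm N →L[ℝ] Herm N, HasFDerivAt (polyHerm p) D A ∧
      D.det = ∏ i, ∏ j, divDiff p (l i) (l j) := by
  obtain ⟨D, hD, hD'⟩ := exists_hasFDerivAt_aeval p hA
  -- Hermitian matrices are not closed under products, so the derivative is taken in the full matrix
  -- algebra; `P` projects back and fixes Hermitian matrices.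
  let P := selfAdjointPartL ℝ (Matrix (Fin N) (Fin N) ℂ)
  let ι : Herm N →L[ℝ] Matrix (Fin N) (Fin N) ℂ :=
    LinearMap.toContinuousLinearMap (selfAdjoint.submodule ℝ (Matrix (Fin N) (Fin N) ℂ)).subtype
  have hP : ∀ B : Herm N, P B = B := fun B => by
    have := LinearMap.congr_fun
      (selfAdjointPart_comp_subtype_selfAdjoint ℝ (A := Matrix (Fin N) (Fin N) ℂ)) B
    exact this
  let e : (Fin N × Fin N → ℝ) ≃ₗ[ℝ] Herm N := hermCoordEquiv N ≪≫ₗ conjHerm U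
  let d : Fin N × Fin N → ℝ := fun q => divDiff p (l q.1) (l q.2)
  let Δ : (Fin N × Fin N → ℝ) →ₗ[ℝ] (Fin N × Fin N → ℝ) :=
    LinearMap.pi fun q => (d q • LinearMap.id) ∘ₗ LinearMap.proj q
  have he : ∀ x, (e x : Matrix (Fin N) (Fin N) ℂ) =
      U * (hermOfCoord N x : Matrix (Fin N) (Fin N) ℂ) * star (U : Matrix (Fin N) (Fin N) ℂ) :=
    fun x => rfl
  have hU : (star U : Matrix (Fin N) (Fin N) ℂ) * U = 1 := Unitary.coe_star_mul_self U
  have hU' : (U : Matrix (Fin N) (Fin N) ℂ) * star (U : Matrix (Fin N) (Fin N) ℂ) = 1 :=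
    Unitary.coe_mul_star_self U
  have key : ∀ x, D (e x : Matrix (Fin N) (Fin N) ℂ) = (e (Δ x) : Matrix (Fin N) (Fin N) ℂ) := by
    intro x
    have h1 : star (U : Matrix (Fin N) (Fin N) ℂ) * D (e x : Matrix (Fin N) (Fin N) ℂ) * U =
        hermOfCoord N (Δ x) := by
      ext i j
      rw [hD', he, show ∀ V X : Matrix (Fin N) (Fin N) ℂ, star V * (V * X * star V) * V =
        (star V * V) * X * (star V * V) by intros; noncomm_ring, hU, mul_one, one_mul]
      -- A single matrix entry mixes the coordinates `(i, j)` and `(j, i)`, so the symmetry of `d`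
      -- is essential.
      have hd : d (j, i) = d (i, j) := divDiff_comm _ _ _
      have hd' : divDiff p (l i) (l j) = d (i, j) := rfl
      simp only [hermOfCoord, Matrix.of_apply, Δ, LinearMap.pi_apply, LinearMap.comp_apply,
        LinearMap.proj_apply, LinearMap.smul_apply, LinearMap.id_apply, smul_eq_mul, hd, hd']
      split_ifs with h
      · subst h; push_cast; rfl
      · push_cast; ring
      · push_cast; ring
    rw [he (Δ x), ← h1, show ∀ V X : Matrix (Fin N) (Fin N) ℂ, V * (star V * X * V) * star V =
      (V * star V) * X * (V * star V) by intros; noncomm_ring, hU', mul_one, one_mul]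
  refine ⟨P ∘L D ∘L ι, ?_, ?_⟩
  · have h1 : HasFDerivAt (fun B : Herm N => P (aeval (ι B) p)) (P ∘L D ∘L ι) A :=
      P.hasFDerivAt.comp A (HasFDerivAt.comp A (f := ι) (show HasFDerivAt _ D (ι A) from hD)
        ι.hasFDerivAt)
    exact h1.congr_of_eventuallyEq (Eventually.of_forall fun B => (hP (polyHerm p B)).symm)
  · have h2 : ((P ∘L D ∘L ι : Herm N →L[ℝ] Herm N) : Herm N →ₗ[ℝ] Herm N) =
        (e : (Fin N × Fin N → ℝ) →ₗ[ℝ] Herm N) ∘ₗ Δ ∘ₗ (e.symm : Herm N →ₗ[ℝ] _) := by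
      ext1 B
      obtain ⟨x, rfl⟩ := e.surjective B
      have : P (D (e x : Matrix (Fin N) (Fin N) ℂ)) = e (Δ x) := by rw [key, hP]
      change P (D (ι (e x))) = e (Δ (e.symm (e x)))
      rw [e.symm_apply_apply]
      exact this
    rw [ContinuousLinearMap.det, h2, LinearMap.det_conj, LinearMap.det_pi, Fintype.prod_prod_type]
    simp [d]

/-! ### Entropy and changes of variables -/

/-- Lusin–Souslin: an injective Borel map on a standard Borel set is a measurable embedding. The
inverse is needed to write the density of an image measure. -/
theorem MeasurableSet.exists_measurable_leftInverse {Ω : Type*} [MeasurableSpace Ω]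
    [StandardBorelSpace Ω] [Nonempty Ω] {s : Set Ω} (hs : MeasurableSet s) {Φ : Ω → Ω}
    (hΦ : Measurable Φ) (hinj : Set.InjOn Φ s) :
    ∃ ψ : Ω → Ω, Measurable ψ ∧ ∀ x ∈ s, ψ (Φ x) = x := by
  rcases s.eq_empty_or_nonempty with rfl | ⟨x₀, hx₀⟩
  · exact ⟨id, measurable_id, by simp⟩
  have he : MeasurableEmbedding (s.domRestrict Φ) :=
    have := hs.standardBorel
    (hΦ.comp measurable_subtype_coe).measurableEmbedding (Set.injOn_iff_injective.1 hinj)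
  have : Nonempty s := ⟨⟨x₀, hx₀⟩⟩
  refine ⟨fun y => (he.invFun y : Ω), measurable_subtype_coe.comp he.measurable_invFun,
    fun x hx => ?_⟩
  exact congrArg Subtype.val (he.leftInverse_invFun ⟨x, hx⟩)

theorem classicalEnt_eq {Ω : Type*} [MeasurableSpace Ω] {lam μ : Measure Ω} [SigmaFinite lam]
    [IsProbabilityMeasure μ] (h : μ ≪ lam)
    (hi : Integrable (fun x => Real.log (μ.rnDeriv lam x).toReal) μ) :
    classicalEnt lam μ = ((-∫ x, Real.log (μ.rnDeriv lam x).toReal ∂μ : ℝ) : EReal) := by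
  rw [classicalEnt, if_pos ⟨h, hi⟩]
  have := integral_rnDeriv_smul (f := fun x => Real.log (μ.rnDeriv lam x).toReal) h
  simp only [smul_eq_mul] at this
  rw [this]

/-- Pushing a measure forward by an injective change of variables with Jacobian `J` decreases the
entropy by at most `-∫ log J`. -/
theorem classicalEnt_le_classicalEnt_map_add {Ω : Type*} [MeasurableSpace Ω]
    [StandardBorelSpace Ω] {lam μ : Measure Ω} [SigmaFinite lam] [IsProbabilityMeasure μ]
    {s : Set Ω} (hs : MeasurableSet s) (hμ : μ sᶜ = 0) {Φ : Ω → Ω} (hΦ : Measurable Φ)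
    (hinj : Set.InjOn Φ s) {J : Ω → ℝ} (hJ : Measurable J) (hJpos : ∀ x ∈ s, 0 < J x)
    (hmap : ((lam.restrict s).withDensity fun x => ENNReal.ofReal (J x)).map Φ =
      lam.restrict (Φ '' s)) {b L : ℝ} (hb : ∀ x ∈ s, |Real.log (J x)| ≤ b)
    (hL : -L ≤ ∫ x, Real.log (J x) ∂μ) :
    classicalEnt lam μ ≤ classicalEnt lam (μ.map Φ) + (L : EReal) := by
  by_cases h : μ ≪ lam ∧ Integrable (fun x => Real.log (μ.rnDeriv lam x).toReal) μ
  swap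
  · rw [classicalEnt, if_neg h]; exact bot_le
  obtain ⟨hac, hi⟩ := h
  have : Nonempty Ω := by
    by_contra hne
    rw [not_nonempty_iff] at hne
    exact IsProbabilityMeasure.ne_zero μ (Measure.eq_zero_of_isEmpty μ)
  have : IsProbabilityMeasure (μ.map Φ) := Measure.isProbabilityMeasure_map hΦ.aemeasurable
  have hae : ∀ᵐ x ∂μ, x ∈ s := hμ
  obtain ⟨ψ, hψ, hψΦ⟩ := hs.exists_measurable_leftInverse hΦ hinj
  set f := μ.rnDeriv lam with hf
  have hfm : Measurable f := Measure.measurable_rnDeriv μ lam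
  have hims : MeasurableSet (Φ '' s) := hs.image_of_measurable_injOn hΦ hinj
  -- The density of the image measure on `Φ '' s`: `f / J` carried over by the inverse `ψ`.
  let G : Ω → ENNReal := fun y => f (ψ y) / ENNReal.ofReal (J (ψ y))
  have hG : Measurable G := (hfm.comp hψ).div (hJ.comp hψ).ennreal_ofReal
  have hJm : Measurable fun x => ENNReal.ofReal (J x) := hJ.ennreal_ofReal
  have hμf : μ =
      ((lam.restrict s).withDensity fun x => ENNReal.ofReal (J x)).withDensity (G ∘ Φ) := by
    rw [← withDensity_mul _ hJm (hG.comp hΦ)]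
    have e1 : μ = (lam.restrict s).withDensity f := by
      rw [← restrict_withDensity hs, Measure.withDensity_rnDeriv_eq μ lam hac,
        Measure.restrict_eq_self_of_ae_mem hae]
    rw [e1]
    refine withDensity_congr_ae ?_
    filter_upwards [ae_restrict_mem hs] with x hx
    have : ENNReal.ofReal (J x) ≠ 0 := by simpa using hJpos x hx
    simp only [Pi.mul_apply, Function.comp, G, hψΦ x hx]
    rw [ENNReal.mul_div_cancel this ENNReal.ofReal_ne_top]
  have hν : μ.map Φ = lam.withDensity ((Φ '' s).indicator G) := by
    rw [withDensity_indicator hims, ← hmap]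
    nth_rewrite 1 [hμf]
    ext t ht
    rw [Measure.map_apply hΦ ht, withDensity_apply _ (hΦ ht), withDensity_apply _ ht,
      setLIntegral_map ht hG hΦ]
    rfl
  have hνac : μ.map Φ ≪ lam := hν ▸ withDensity_absolutelyContinuous _ _
  have hrn : ∀ᵐ y ∂(μ.map Φ), (μ.map Φ).rnDeriv lam y = (Φ '' s).indicator G y := by
    refine hνac.ae_le ?_
    nth_rewrite 1 [hν]
    exact Measure.rnDeriv_withDensity lam (hG.indicator hims)
  have hlog : ∀ᵐ x ∂μ, Real.log ((μ.map Φ).rnDeriv lam (Φ x)).toReal =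
      Real.log (f x).toReal - Real.log (J x) := by
    -- For `μ`-almost every point `f` is positive and finite, so the logarithm of `f / J` splits.
    filter_upwards [ae_of_ae_map hΦ.aemeasurable hrn, hae, Measure.rnDeriv_pos hac,
      hac.ae_le (Measure.rnDeriv_lt_top μ lam)] with x h1 h2 h3 h4
    rw [h1, Set.indicator_of_mem (Set.mem_image_of_mem Φ h2)]
    simp only [G, hψΦ x h2, ENNReal.toReal_div]
    rw [ENNReal.toReal_ofReal (hJpos x h2).le, Real.log_div (ENNReal.toReal_pos h3.ne' h4.ne).ne'
      (hJpos x h2).ne']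
  have hJi : Integrable (fun x => Real.log (J x)) μ :=
    Integrable.of_bound hJ.log.aestronglyMeasurable b (by
      filter_upwards [hae] with x hx using hb x hx)
  have hmeas : Measurable fun y => Real.log ((μ.map Φ).rnDeriv lam y).toReal :=
    (Measure.measurable_rnDeriv _ _).ennreal_toReal.log
  have hi' : Integrable (fun y => Real.log ((μ.map Φ).rnDeriv lam y).toReal) (μ.map Φ) := by
    rw [integrable_map_measure hmeas.aestronglyMeasurable hΦ.aemeasurable]
    exact (hi.sub hJi).congr (by filter_upwards [hlog] with x hx using hx.symm)
  rw [classicalEnt_eq hac hi, classicalEnt_eq hνac hi', ← EReal.coe_add, EReal.coe_le_coe_iff,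
    integral_map hΦ.aemeasurable hmeas.aestronglyMeasurable, integral_congr_ae hlog,
    integral_sub hi hJi]
  linarith

/-! ### Polynomial changes of variables on tuples of Hermitian matrices -/

theorem mem_hermBall {n N : ℕ} {R : ℝ} {M : Fin n → Herm N} :
    M ∈ hermBall n N R ↔ ∀ i, ‖(M i : Matrix (Fin N) (Fin N) ℂ)‖ ≤ R := Iff.rfl

theorem isClosed_hermBall (n N : ℕ) (R : ℝ) : IsClosed (hermBall n N R) := by
  have : hermBall n N R = ⋂ i, {M | ‖(M i : Matrix (Fin N) (Fin N) ℂ)‖ ≤ R} := by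
    ext M; simp [mem_hermBall]
  rw [this]
  exact isClosed_iInter fun i => isClosed_le (by fun_prop) continuous_const

/-- The map `(M₁, …, Mₙ) ↦ (p(M₁), …, p(Mₙ))`. -/
def polyTuple {n N : ℕ} (p : Polynomial ℝ) (M : Fin n → Herm N) : Fin n → Herm N :=
  fun i => polyHerm p (M i)

theorem Herm.exists_diagonalization_of_norm_le {N : ℕ} {A : Herm N} {T : ℝ}
    (hA : ‖(A : Matrix (Fin N) (Fin N) ℂ)‖ ≤ T) :
    ∃ (U : unitary (Matrix (Fin N) (Fin N) ℂ)) (l : Fin N → ℝ),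
      (A : Matrix (Fin N) (Fin N) ℂ) =
        U * Matrix.diagonal (fun i => (l i : ℂ)) * star (U : Matrix (Fin N) (Fin N) ℂ) ∧
      ∀ i, l i ∈ Set.Icc (-T) T := by
  obtain ⟨U, l, h⟩ := A.exists_diagonalization
  refine ⟨U, l, h, fun i => ?_⟩
  rw [h, norm_unitary_conj_diagonal] at hA
  exact abs_le.1 ((norm_le_pi_norm l i).trans hA)

theorem norm_polyHerm_le {N : ℕ} {p : Polynomial ℝ} {R T : ℝ} (hR : 0 ≤ R)
    (hp : ∀ x ∈ Set.Icc (-T) T, |p.eval x| ≤ R) {A : Herm N}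
    (hA : ‖(A : Matrix (Fin N) (Fin N) ℂ)‖ ≤ T) :
    ‖(polyHerm p A : Matrix (Fin N) (Fin N) ℂ)‖ ≤ R := by
  obtain ⟨U, l, h, hl⟩ := Herm.exists_diagonalization_of_norm_le hA
  rw [coe_polyHerm, h, aeval_unitary_conj_diagonal,
    norm_unitary_conj_diagonal U fun i => p.eval (l i), pi_norm_le_iff_of_nonneg hR]
  exact fun i => hp _ (hl i)

/-- Interpolation gives one polynomial `q` inverting `p` on both spectra, so `A = q(p(A)) = q(p(B))
= B`. -/
theorem polyHerm_injOn {N : ℕ} {p : Polynomial ℝ} {T : ℝ}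
    (hp : Set.InjOn (fun x => p.eval x) (Set.Icc (-T) T)) {A B : Herm N}
    (hA : ‖(A : Matrix (Fin N) (Fin N) ℂ)‖ ≤ T) (hB : ‖(B : Matrix (Fin N) (Fin N) ℂ)‖ ≤ T)
    (h : polyHerm p A = polyHerm p B) : A = B := by
  obtain ⟨U, l, hU, hl⟩ := Herm.exists_diagonalization_of_norm_le hA
  obtain ⟨V, m, hV, hm⟩ := Herm.exists_diagonalization_of_norm_le hB
  classical
  let S : Finset ℝ := Finset.univ.image l ∪ Finset.univ.image m
  have hS : Set.InjOn (fun x => p.eval x) S := hp.mono fun x hx => by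
    simp only [S, Finset.coe_union, Finset.coe_image, Set.mem_union] at hx
    rcases hx with ⟨i, -, rfl⟩ | ⟨i, -, rfl⟩
    exacts [hl i, hm i]
  let q : Polynomial ℝ := Lagrange.interpolate S (fun x => p.eval x) id
  have hq : ∀ x ∈ S, q.eval (p.eval x) = x := fun x hx =>
    Lagrange.eval_interpolate_at_node id hS hx
  have hcomp : ∀ C : Herm N, aeval (polyHerm p C : Matrix (Fin N) (Fin N) ℂ) q =
      aeval (C : Matrix (Fin N) (Fin N) ℂ) (q.comp p) := fun C => by
    rw [Polynomial.aeval_comp, coe_polyHerm]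
  have hAq : aeval (polyHerm p A : Matrix (Fin N) (Fin N) ℂ) q = A := by
    rw [hcomp, hU, aeval_unitary_conj_diagonal]
    congr 3
    ext i
    rw [Polynomial.eval_comp, hq _ (by simp [S])]
  have hBq : aeval (polyHerm p B : Matrix (Fin N) (Fin N) ℂ) q = B := by
    rw [hcomp, hV, aeval_unitary_conj_diagonal]
    congr 3
    ext i
    rw [Polynomial.eval_comp, hq _ (by simp [S])]
  ext1
  rw [← hAq, ← hBq, h]

theorem polyTuple_mem_hermBall {n N : ℕ} {p : Polynomial ℝ} {R T : ℝ} (hR : 0 ≤ R)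
    (hp : ∀ x ∈ Set.Icc (-T) T, |p.eval x| ≤ R) {M : Fin n → Herm N} (hM : M ∈ hermBall n N T) :
    polyTuple p M ∈ hermBall n N R :=
  fun i => norm_polyHerm_le hR hp (hM i)

theorem continuous_polyHerm {N : ℕ} (p : Polynomial ℝ) :
    Continuous (polyHerm p : Herm N → Herm N) :=
  Continuous.subtype_mk (p.continuous_aeval.comp continuous_subtype_val) _

theorem continuous_polyTuple {n N : ℕ} (p : Polynomial ℝ) :
    Continuous (polyTuple p : (Fin n → Herm N) → _) :=
  continuous_pi fun i => (continuous_polyHerm p).comp (continuous_apply i)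

theorem polyTuple_injOn {n N : ℕ} {p : Polynomial ℝ} {T : ℝ}
    (hp : Set.InjOn (fun x => p.eval x) (Set.Icc (-T) T)) :
    Set.InjOn (polyTuple p) (hermBall n N T) :=
  fun _ hA _ hB h => funext fun k => polyHerm_injOn hp (hA k) (hB k) (congrFun h k)

/-- The Jacobian of `polyTuple p`. -/
def polyJac {n N : ℕ} (p : Polynomial ℝ) (M : Fin n → Herm N) : ℝ :=
  |(fderiv ℝ (polyTuple p) M).det|

theorem measurable_polyJac {n N : ℕ} (p : Polynomial ℝ) :
    Measurable (polyJac p : (Fin n → Herm N) → ℝ) := by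
  change Measurable fun M : Fin n → Herm N => |(fderiv ℝ (polyTuple p) M).det|
  exact (ContinuousLinearMap.continuous_det.measurable.comp
    (measurable_fderiv ℝ (polyTuple p : (Fin n → Herm N) → Fin n → Herm N))).abs

theorem exists_hasFDerivAt_piMap {ι E : Type*} [Fintype ι] [NormedAddCommGroup E]
    [NormedSpace ℝ E] [FiniteDimensional ℝ E] {f : E → E} {x : ι → E} {D : ι → E →L[ℝ] E}
    (hD : ∀ k, HasFDerivAt f (D k) (x k)) :
    ∃ D' : (ι → E) →L[ℝ] (ι → E), HasFDerivAt (fun y k => f (y k)) D' x ∧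
      D'.det = ∏ k, (D k).det :=
  ⟨ContinuousLinearMap.pi fun k => (D k).comp (ContinuousLinearMap.proj k),
    hasFDerivAt_pi.2 fun k => (hD k).comp x (hasFDerivAt_apply k x),
    ContinuousLinearMap.det_pi _⟩

theorem exists_hasFDerivAt_polyTuple {n N : ℕ} (p : Polynomial ℝ) {M : Fin n → Herm N}
    {U : Fin n → unitary (Matrix (Fin N) (Fin N) ℂ)} {l : Fin n → Fin N → ℝ}
    (hM : ∀ k, (M k : Matrix (Fin N) (Fin N) ℂ) =
      U k * Matrix.diagonal (fun i => (l k i : ℂ)) * star (U k : Matrix (Fin N) (Fin N) ℂ)) :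
    ∃ D : (Fin n → Herm N) →L[ℝ] (Fin n → Herm N), HasFDerivAt (polyTuple p) D M ∧
      D.det = ∏ k, ∏ i, ∏ j, divDiff p (l k i) (l k j) := by
  choose D hD hdet using fun k => exists_hasFDerivAt_polyHerm p (hM k)
  obtain ⟨E, hE, hE'⟩ := exists_hasFDerivAt_piMap hD
  exact ⟨E, hE, hE'.trans (Finset.prod_congr rfl fun k _ => hdet k)⟩

theorem polyJac_eq {n N : ℕ} (p : Polynomial ℝ) {M : Fin n → Herm N}
    {U : Fin n → unitary (Matrix (Fin N) (Fin N) ℂ)} {l : Fin n → Fin N → ℝ}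
    (hM : ∀ k, (M k : Matrix (Fin N) (Fin N) ℂ) =
      U k * Matrix.diagonal (fun i => (l k i : ℂ)) * star (U k : Matrix (Fin N) (Fin N) ℂ)) :
    polyJac p M = |∏ k, ∏ i, ∏ j, divDiff p (l k i) (l k j)| := by
  obtain ⟨D, hD, hdet⟩ := exists_hasFDerivAt_polyTuple p hM
  rw [polyJac, hD.fderiv, hdet]

theorem map_withDensity_polyJac {n N : ℕ} {p : Polynomial ℝ} {T : ℝ}
    (hp : Set.InjOn (fun x => p.eval x) (Set.Icc (-T) T)) :
    (((hermLebesgueTuple n N).restrict (hermBall n N T)).withDensity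
      fun M => ENNReal.ofReal (polyJac p M)).map (polyTuple p) =
      (hermLebesgueTuple n N).restrict (polyTuple p '' hermBall n N T) := by
  have hd : ∀ M ∈ hermBall n N T, HasFDerivWithinAt (polyTuple p)
      (fderiv ℝ (polyTuple p) M) (hermBall n N T) M := fun M _ => by
    choose U l hU using fun k => (M k).exists_diagonalization
    obtain ⟨D, hD, -⟩ := exists_hasFDerivAt_polyTuple p hU
    rw [hD.fderiv]
    exact hD.hasFDerivWithinAt
  have hi : Set.InjOn (polyTuple p) (hermBall n N T) :=
    polyTuple_injOn hp
  exact map_withDensity_abs_det_fderiv_eq_addHaar (hermLebesgueTuple n N)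
    (isClosed_hermBall n N T).measurableSet.nullMeasurableSet hd hi

/-! ### Tracial states of tuples of Hermitian matrices -/

theorem evalAt_mono {n : ℕ} {A : Type*} [Ring A] [Algebra ℂ A] (a : Fin n → A)
    (w : FreeMonoid (Fin n)) : evalAt a (mono w) = FreeMonoid.lift a w := by
  simp [evalAt, mono]

theorem evalAt_X {n : ℕ} {A : Type*} [Ring A] [Algebra ℂ A] (a : Fin n → A) (i : Fin n) :
    evalAt a (X i) = a i := by
  rw [X, evalAt_mono, FreeMonoid.lift_eval_of]

theorem adj_add {n : ℕ} (P Q : NCPoly n) : adj (P + Q) = adj P + adj Q := by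
  unfold adj
  rw [MonoidAlgebra.coeff_add, Finsupp.sum_add_index'] <;> simp

theorem adj_single {n : ℕ} (w : FreeMonoid (Fin n)) (c : ℂ) :
    adj (MonoidAlgebra.single w c) = MonoidAlgebra.single (star w) (star c) := by
  unfold adj
  rw [MonoidAlgebra.coeff_single, Finsupp.sum_single_index]; simp

theorem adj_X {n : ℕ} (i : Fin n) : adj (X i) = X i := by
  change adj (MonoidAlgebra.single _ _) = MonoidAlgebra.single _ _
  rw [adj_single, FreeMonoid.star_of, star_one]

theorem lift_star {n : ℕ} {A : Type*} [Monoid A] [StarMul A] {a : Fin n → A}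
    (ha : ∀ i, star (a i) = a i) (w : FreeMonoid (Fin n)) :
    FreeMonoid.lift a (star w) = star (FreeMonoid.lift a w) := by
  induction w using FreeMonoid.inductionOn' with
  | one => simp
  | of_mul x xs ih => simp [ih, ha]

theorem evalAt_adj {n N : ℕ} (M : Fin n → Herm N) (P : NCPoly n) :
    evalAt (fun i => (M i : Matrix (Fin N) (Fin N) ℂ)) (adj P) =
      star (evalAt (fun i => (M i : Matrix (Fin N) (Fin N) ℂ)) P) := by
  induction P using MonoidAlgebra.induction_linear with
  | zero => simp [adj]
  | add P Q hP hQ => rw [adj_add, map_add, hP, hQ, map_add, star_add]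
  | single w c =>
    rw [adj_single]
    simp only [evalAt, MonoidAlgebra.lift_single, star_smul]
    rw [lift_star fun i => (M i).2]

theorem norm_matrix_apply_le {N : ℕ} (B : Matrix (Fin N) (Fin N) ℂ) (i j : Fin N) :
    ‖B i j‖ ≤ ‖B‖ := by
  have h := Matrix.l2_opNorm_mulVec B (EuclideanSpace.single j 1)
  rw [PiLp.norm_single, norm_one, mul_one] at h
  refine le_trans ?_ h
  have := PiLp.norm_apply_le (WithLp.toLp 2 (B.mulVec (EuclideanSpace.single j (1 : ℂ)).ofLp)) i
  simpa using this

theorem norm_trace_le {N : ℕ} (B : Matrix (Fin N) (Fin N) ℂ) : ‖B.trace‖ ≤ N * ‖B‖ := by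
  refine (norm_sum_le _ _).trans ((Finset.sum_le_card_nsmul _ _ ‖B‖ fun i _ =>
    norm_matrix_apply_le B i i).trans_eq ?_)
  simp

theorem norm_normalizedTrace_le {N : ℕ} {B : Matrix (Fin N) (Fin N) ℂ} {C : ℝ} (hC : ‖B‖ ≤ C) :
    ‖1 / (N : ℂ) * B.trace‖ ≤ C := by
  have hC0 := (norm_nonneg B).trans hC
  rcases Nat.eq_zero_or_pos N with rfl | hN
  · simpa using hC0
  · have : (0 : ℝ) < N := by exact_mod_cast hN
    rw [norm_mul, norm_div, norm_one, Complex.norm_natCast, one_div, inv_mul_le_iff₀ this]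
    exact (norm_trace_le B).trans (by gcongr)

theorem norm_lift_le {n : ℕ} {A : Type*} [NormedRing A] [NormOneClass A] {a : Fin n → A} {S : ℝ}
    (ha : ∀ i, ‖a i‖ ≤ S) (w : FreeMonoid (Fin n)) : ‖FreeMonoid.lift a w‖ ≤ S ^ w.length := by
  induction w using FreeMonoid.inductionOn' with
  | one => simp
  | of_mul x xs ih =>
    have hS : 0 ≤ S := (norm_nonneg _).trans (ha x)
    rw [map_mul, FreeMonoid.lift_eval_of, FreeMonoid.length_mul, FreeMonoid.length_of, pow_add,
      pow_one]
    exact (norm_mul_le _ _).trans (by gcongr; exact ha x)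

/-- One constant serves all tuples in the ball, which gives integrability and the moment bounds of
barycenters. -/
theorem exists_norm_evalAt_le {n : ℕ} (S : ℝ) (P : NCPoly n) :
    ∃ C, 0 < C ∧ ∀ {A : Type} [NormedRing A] [NormedAlgebra ℂ A] [NormOneClass A] (a : Fin n → A),
      (∀ i, ‖a i‖ ≤ S) → ‖evalAt a P‖ ≤ C := by
  induction P using MonoidAlgebra.induction_linear with
  | zero => exact ⟨1, one_pos, fun a _ => by simp⟩
  | add P Q hP hQ =>
    obtain ⟨C, hC, h⟩ := hP
    obtain ⟨D, hD, h'⟩ := hQ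
    exact ⟨C + D, by positivity, fun a ha => by
      rw [map_add]; exact (norm_add_le _ _).trans (add_le_add (h a ha) (h' a ha))⟩
  | single w c =>
    -- The `+ 1` keeps the constant positive, as `IsTraceState.bounded` demands, even if `c = 0`.
    refine ⟨‖c‖ * |S| ^ w.length + 1, by positivity, fun a ha => ?_⟩
    simp only [evalAt, MonoidAlgebra.lift_single]
    rw [norm_smul]
    have := norm_lift_le (fun i => (ha i).trans (le_abs_self S)) w
    nlinarith [norm_nonneg c]

theorem continuous_matrixState {n N : ℕ} (P : NCPoly n) :
    Continuous fun M : Fin n → Herm N => matrixState M P := by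
  refine continuous_const.mul (Continuous.matrix_trace ?_)
  induction P using MonoidAlgebra.induction_linear with
  | zero => simpa using continuous_const
  | add P Q hP hQ => simp only [map_add]; exact hP.add hQ
  | single w c =>
    simp only [evalAt, MonoidAlgebra.lift_single]
    refine Continuous.const_smul ?_ c
    induction w using FreeMonoid.inductionOn' with
    | one => simpa using continuous_const
    | of_mul x xs ih =>
      simp only [map_mul, FreeMonoid.lift_eval_of]
      exact (continuous_subtype_val.comp (continuous_apply x)).mul ih

theorem ae_mem_hermBall {n N : ℕ} {R : ℝ} {μ : Measure (Fin n → Herm N)}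
    (hμ : μ ∈ ballProb n N R) : ∀ᵐ M ∂μ, M ∈ hermBall n N R := hμ.2

theorem integrable_matrixState {n N : ℕ} [NeZero N] {R : ℝ} {μ : Measure (Fin n → Herm N)}
    (hμ : μ ∈ ballProb n N R) (P : NCPoly n) : Integrable (fun M => matrixState M P) μ := by
  have := hμ.1
  obtain ⟨C, -, hC⟩ := exists_norm_evalAt_le R P
  refine Integrable.of_bound (continuous_matrixState P).measurable.aestronglyMeasurable C ?_
  filter_upwards [ae_mem_hermBall hμ] with M hM
  exact norm_normalizedTrace_le (hC (A := Matrix (Fin N) (Fin N) ℂ) _ hM)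

theorem norm_barycenter_le {n N : ℕ} {R C : ℝ} {μ : Measure (Fin n → Herm N)}
    (hμ : μ ∈ ballProb n N R) {P : NCPoly n}
    (hC : ∀ M ∈ hermBall n N R, ‖evalAt (fun i => (M i : Matrix (Fin N) (Fin N) ℂ)) P‖ ≤ C) :
    ‖barycenter μ P‖ ≤ C := by
  have := hμ.1
  refine (norm_integral_le_of_norm_le_const (C := C) ?_).trans_eq (by simp)
  filter_upwards [ae_mem_hermBall hμ] with M hM
  exact norm_normalizedTrace_le (hC M hM)

/-- The barycenter of a compactly supported measure as a linear functional. -/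
def barycenterState {n N : ℕ} [NeZero N] {R : ℝ} {μ : Measure (Fin n → Herm N)}
    (hμ : μ ∈ ballProb n N R) : NCPoly n →ₗ[ℂ] ℂ where
  toFun := barycenter μ
  map_add' P Q := by
    unfold barycenter
    rw [← integral_add (integrable_matrixState hμ P) (integrable_matrixState hμ Q)]
    simp only [matrixState, map_add, Matrix.trace_add, mul_add]
  map_smul' c P := by
    simp only [RingHom.id_apply, smul_eq_mul]
    unfold barycenter
    rw [← integral_const_mul]
    simp only [matrixState, map_smul, Matrix.trace_smul, smul_eq_mul, mul_left_comm]

/-- The `C*`-identity gives `‖(B* B)^k‖ ≤ ‖B‖^(2k)` at every point of the ball. -/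
theorem momentBound_barycenterState {n N : ℕ} [NeZero N] {R C : ℝ} {μ : Measure (Fin n → Herm N)}
    (hμ : μ ∈ ballProb n N R) {P : NCPoly n}
    (hC : ∀ M ∈ hermBall n N R, ‖evalAt (fun i => (M i : Matrix (Fin N) (Fin N) ℂ)) P‖ ≤ C) :
    MomentBound (barycenterState hμ) P C := by
  intro k
  refine (Complex.re_le_norm _).trans (norm_barycenter_le hμ fun M hM => ?_)
  rw [map_pow, map_mul, evalAt_adj]
  refine (norm_pow_le _ _).trans ?_
  rw [CStarRing.norm_star_mul_self, ← pow_two, ← pow_mul]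
  exact pow_le_pow_left₀ (norm_nonneg _) (hC M hM) _

theorem matrixState_adj_mul_self {n N : ℕ} (M : Fin n → Herm N) (P : NCPoly n) :
    ∃ r : ℝ, 0 ≤ r ∧ matrixState M (adj P * P) = r := by
  rw [matrixState, map_mul, evalAt_adj]
  set B := evalAt (fun i => (M i : Matrix (Fin N) (Fin N) ℂ)) P
  refine ⟨1 / N * ∑ i, ∑ j, ‖B j i‖ ^ 2, by positivity, ?_⟩
  simp only [Matrix.trace, Matrix.diag, Matrix.mul_apply, Matrix.star_apply, RCLike.star_def,
    Complex.conj_mul']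
  push_cast
  rfl

/-- Each normalized matrix trace has these properties and they survive averaging; `N ≠ 0` is what
gives the unit value `1`. -/
theorem barycenterState_mem_traceStates {n N : ℕ} [NeZero N] {R : ℝ} (hR : 0 ≤ R)
    {μ : Measure (Fin n → Herm N)} (hμ : μ ∈ ballProb n N R) :
    barycenterState hμ ∈ traceStates n R := by
  have := hμ.1
  refine ⟨⟨fun P => ?_, fun P => ?_, fun P Q => ?_, ?_, fun P => ?_⟩, hR, fun i => ?_⟩
  · change ∫ M, matrixState M (adj P) ∂μ = star (∫ M, matrixState M P ∂μ)
    rw [RCLike.star_def, ← integral_conj]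
    refine integral_congr_ae (Eventually.of_forall fun M => ?_)
    simp only [matrixState, evalAt_adj, Matrix.star_eq_conjTranspose, Matrix.trace_conjTranspose]
    simp
  · choose r hr h using fun M : Fin n → Herm N => matrixState_adj_mul_self M P
    have e : barycenterState hμ (adj P * P) = ((∫ M, r M ∂μ : ℝ) : ℂ) := by
      change ∫ M, matrixState M (adj P * P) ∂μ = _
      simp only [h]
      exact integral_ofReal
    rw [e]
    exact ⟨integral_nonneg hr, Complex.ofReal_im _⟩
  · change ∫ M, matrixState M (P * Q) ∂μ = ∫ M, matrixState M (Q * P) ∂μ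
    refine integral_congr_ae (Eventually.of_forall fun M => ?_)
    simp only [matrixState, map_mul]
    rw [Matrix.trace_mul_comm]
  · change ∫ M, matrixState M 1 ∂μ = 1
    simp [matrixState, NeZero.ne]
  · obtain ⟨C, hC0, hC⟩ := exists_norm_evalAt_le R P
    exact ⟨C, hC0, momentBound_barycenterState hμ fun M hM =>
      hC (A := Matrix (Fin N) (Fin N) ℂ) _ hM⟩
  · exact momentBound_barycenterState hμ fun M hM => by rw [evalAt_X]; exact hM i

/-! ### Polynomials compressing an interval -/

theorem Polynomial.exists_derivative_eq (q : Polynomial ℝ) :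
    ∃ p : Polynomial ℝ, p.derivative = q ∧ p.eval 0 = 0 := by
  induction q using Polynomial.induction_on' with
  | add q r hq hr =>
    obtain ⟨p, h, h'⟩ := hq
    obtain ⟨s, e, e'⟩ := hr
    exact ⟨p + s, by simp [h, e], by simp [h', e']⟩
  | monomial n a =>
    refine ⟨Polynomial.monomial (n + 1) (a / (n + 1)), ?_, by simp⟩
    rw [Polynomial.derivative_monomial]
    have : (n + 1 : ℝ) ≠ 0 := by positivity
    simp [this]

theorem Polynomial.abs_eval_sub_le (p : Polynomial ℝ) {a b C : ℝ}
    (h : ∀ x ∈ Set.Icc a b, |p.derivative.eval x| ≤ C) {x y : ℝ} (hx : x ∈ Set.Icc a b)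
    (hy : y ∈ Set.Icc a b) : |p.eval y - p.eval x| ≤ C * |y - x| := by
  refine (convex_Icc a b).norm_image_sub_le_of_norm_deriv_le (f := fun x => p.eval x)
    (fun x _ => p.differentiableAt) (fun x hx => ?_) hx hy
  rw [Polynomial.deriv]
  exact h x hx

/-- A polynomial that maps `[-T, T]` into `[-R, R]`, has derivative between `c` and `2` there, and
derivative within `η` of `1` on `[-R₁, R₁]`. -/
structure Compresses (p : Polynomial ℝ) (R₁ R T c η : ℝ) : Prop where
  abs_eval_le : ∀ x ∈ Set.Icc (-T) T, |p.eval x| ≤ R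
  le_deriv : ∀ x ∈ Set.Icc (-T) T, c ≤ p.derivative.eval x
  deriv_le : ∀ x ∈ Set.Icc (-T) T, p.derivative.eval x ≤ 2
  abs_deriv_sub_one_le : ∀ x ∈ Set.Icc (-R₁) R₁, |p.derivative.eval x - 1| ≤ η
  eval_zero : p.eval 0 = 0

/-- Polynomials mapping `[-T, T]` into `[-R, R]` with derivative bounded below, and as close to the
identity as desired on `[-R₁, R₁]`. -/
theorem exists_compressing_polynomial {R₁ R T : ℝ} (h0 : 0 ≤ R₁) (h1 : R₁ < R) (h2 : R < T) :
    ∃ c : ℝ, 0 < c ∧ c ≤ 1 ∧ ∀ η > 0, ∃ p : Polynomial ℝ, Compresses p R₁ R T c η := by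
  have hT : 0 < T := by linarith
  -- `R - R₁` is cut into four pieces: one for the transition zone of `g`, the others absorb the
  -- growth beyond it and the approximation errors.
  set θ := (R - R₁) / 4 with hθ
  have hθ0 : 0 < θ := by rw [hθ]; linarith
  set c₀ := θ / T with hc₀
  have hc₀0 : 0 < c₀ := by positivity
  have hc₀T : c₀ * T = θ := by rw [hc₀]; field_simp
  have hc₀1 : c₀ ≤ 1 := by rw [hc₀, div_le_one hT, hθ]; linarith
  -- The lower bound is fixed before `η`; halving `c₀` leaves room for the error `ζ ≤ c₀ / 2`.
  refine ⟨c₀ / 2, by positivity, by linarith, fun η hη => ?_⟩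
  -- The ideal derivative: `1` up to `R₁`, then falling to `c₀` by `R₁ + θ`. Weierstrass is applied
  -- to it, and the result is integrated.
  let g : ℝ → ℝ := fun x => max c₀ (min 1 (1 - (|x| - R₁) / θ))
  have hg : Continuous g := by fun_prop
  have hg1 : ∀ x, |x| ≤ R₁ → g x = 1 := fun x hx => by
    have : (|x| - R₁) / θ ≤ 0 := div_nonpos_of_nonpos_of_nonneg (by linarith) hθ0.le
    simp only [g]
    rw [min_eq_left (by linarith), max_eq_right hc₀1]
  have hg2 : ∀ x, R₁ + θ ≤ |x| → g x = c₀ := fun x hx => by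
    have : 1 ≤ (|x| - R₁) / θ := by rw [le_div_iff₀ hθ0]; linarith
    simp only [g]
    exact max_eq_left ((min_le_right _ _).trans (by linarith))
  have hg3 : ∀ x, c₀ ≤ g x ∧ g x ≤ 1 := fun x =>
    ⟨le_max_left _ _, max_le hc₀1 (min_le_left _ _)⟩
  set ζ := min η (c₀ / 2) with hζ
  have hζ0 : 0 < ζ := lt_min hη (by positivity)
  have hζ1 : ζ ≤ c₀ / 2 := min_le_right _ _
  obtain ⟨q, hq⟩ := exists_polynomial_near_of_continuousOn (-T) T g hg.continuousOn ζ hζ0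
  obtain ⟨p, rfl, hp0⟩ := q.exists_derivative_eq
  refine ⟨p, ?_, fun x hx => ?_, fun x hx => ?_, fun x hx => ?_, hp0⟩
  · set a := R₁ + θ with ha
    have ha0 : 0 ≤ a := by linarith
    have haT : a ≤ T := by rw [ha, hθ]; linarith
    have hin : ∀ x ∈ Set.Icc (-a) a, |p.eval x| ≤ (1 + ζ) * a := fun x hx => by
      have := p.abs_eval_sub_le (a := -a) (b := a) (C := 1 + ζ) (fun y hy => by
        have h := abs_lt.1 (hq y ⟨by linarith [hy.1], by linarith [hy.2]⟩)
        have h' := hg3 y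
        exact abs_le.2 ⟨by linarith, by linarith⟩) (x := 0) ⟨by linarith, ha0⟩ hx
      rw [hp0, sub_zero, sub_zero] at this
      exact this.trans (by gcongr; exact abs_le.2 hx)
    have hout : ∀ y ∈ Set.Icc (-T) T, a ≤ |y| → |p.derivative.eval y| ≤ c₀ + ζ := fun y hy h => by
      have h' := abs_lt.1 (hq y hy)
      rw [hg2 y h] at h'
      exact abs_le.2 ⟨by linarith, by linarith⟩
    -- Here `ζ a ≤ θ / 2` and `(c₀ + ζ) T ≤ 3θ / 2`, so the total is at most `R₁ + 3θ`.
    have hbound : (1 + ζ) * a + (c₀ + ζ) * T ≤ R := by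
      have : ζ * a ≤ c₀ / 2 * T := by gcongr
      have : ζ * T ≤ c₀ / 2 * T := by gcongr
      have : R = R₁ + 4 * θ := by rw [hθ]; ring
      nlinarith
    have hbound' : (1 + ζ) * a ≤ R := by
      have : 0 ≤ (c₀ + ζ) * T := by positivity
      linarith
    intro x hx
    rcases le_total |x| a with h | h
    · exact (hin x (abs_le.1 h)).trans hbound'
    · rcases le_abs'.1 h with h | h
      · have h3 := p.abs_eval_sub_le (a := -T) (b := -a) (fun y hy =>
          hout y ⟨hy.1, by linarith [hy.2]⟩ (le_abs'.2 (Or.inl hy.2)))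
          (x := -a) ⟨by linarith, le_rfl⟩ (y := x) ⟨hx.1, h⟩
        have h4 := hin (-a) ⟨le_rfl, by linarith⟩
        have h5 : |x - -a| ≤ T := abs_le.2 ⟨by linarith [hx.1], by linarith⟩
        have h6 : (c₀ + ζ) * |x - -a| ≤ (c₀ + ζ) * T := by gcongr
        have h7 := abs_sub_abs_le_abs_sub (p.eval x) (p.eval (-a))
        linarith
      · have h3 := p.abs_eval_sub_le (a := a) (b := T) (fun y hy =>
          hout y ⟨by linarith [hy.1], hy.2⟩ (le_abs'.2 (Or.inr hy.1)))
          (x := a) ⟨le_rfl, haT⟩ (y := x) ⟨h, hx.2⟩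
        have h4 := hin a ⟨by linarith, le_rfl⟩
        have h5 : |x - a| ≤ T := abs_le.2 ⟨by linarith, by linarith [hx.2]⟩
        have h6 : (c₀ + ζ) * |x - a| ≤ (c₀ + ζ) * T := by gcongr
        have h7 := abs_sub_abs_le_abs_sub (p.eval x) (p.eval a)
        linarith
  · have h := abs_lt.1 (hq x hx)
    linarith [hg3 x]
  · have h := abs_lt.1 (hq x hx)
    linarith [hg3 x]
  · have h := hq x ⟨by linarith [hx.1], by linarith [hx.2]⟩
    rw [hg1 x (abs_le.2 hx)] at h
    exact h.le.trans (min_le_left _ _)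

/-! ### Scalar estimates for compressing polynomials -/

namespace Compresses

variable {p : Polynomial ℝ} {R₁ R T c η : ℝ}

theorem le_divDiff (hp : Compresses p R₁ R T c η) {x y : ℝ} (hx : x ∈ Set.Icc (-T) T)
    (hy : y ∈ Set.Icc (-T) T) : c ≤ divDiff p x y := by
  obtain ⟨z, hz, e⟩ := exists_divDiff_eq p Set.ordConnected_Icc hx hy
  exact e ▸ hp.le_deriv z hz

theorem divDiff_le (hp : Compresses p R₁ R T c η) {x y : ℝ} (hx : x ∈ Set.Icc (-T) T)
    (hy : y ∈ Set.Icc (-T) T) : divDiff p x y ≤ 2 := by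
  obtain ⟨z, hz, e⟩ := exists_divDiff_eq p Set.ordConnected_Icc hx hy
  exact e ▸ hp.deriv_le z hz

theorem injOn (hp : Compresses p R₁ R T c η) (hc : 0 < c) :
    Set.InjOn (fun x => p.eval x) (Set.Icc (-T) T) := by
  intro x hx y hy h
  by_contra hne
  have := hp.le_divDiff hx hy
  rw [divDiff, if_neg hne, show p.eval x = p.eval y from h, sub_self, zero_div] at this
  linarith

/-- Markov's trick: this even power dominates the indicator of `R₁ ≤ |x|`, and its mean is a moment.
-/
theorem one_le_div_pow (hR₁ : 0 < R₁) (m : ℕ) {x : ℝ} (hx : R₁ ≤ |x|) :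
    1 ≤ (x / R₁) ^ (2 * m) := by
  rw [pow_mul, ← sq_abs, ← pow_mul, abs_div, abs_of_pos hR₁]
  exact one_le_pow₀ ((one_le_div hR₁).2 hx)

theorem div_pow_nonneg (x : ℝ) (m : ℕ) : 0 ≤ (x / R₁) ^ (2 * m) := by
  rw [pow_mul]; positivity

/-- Inside `[-R₁, R₁]`, `p - X` vanishes at `0` and has slope at most `η`; outside, the crude bound
`2T` is charged to the weight. -/
theorem abs_eval_sub_le (hp : Compresses p R₁ R T c η) (hR₁ : 0 < R₁) (hRT : R ≤ T)
    (hR₁T : R₁ ≤ T) (hη : 0 ≤ η) (m : ℕ) {x : ℝ} (hx : x ∈ Set.Icc (-T) T) :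
    |p.eval x - x| ≤ η * T + 2 * T * (x / R₁) ^ (2 * m) := by
  have hT : 0 < T := hR₁.trans_le hR₁T
  have hw := div_pow_nonneg (R₁ := R₁) x m
  rcases le_total |x| R₁ with h | h
  · have := (p - Polynomial.X).abs_eval_sub_le (a := -R₁) (b := R₁) (C := η) (fun y hy => by
      simpa using hp.abs_deriv_sub_one_le y hy) (x := 0) (y := x) ⟨by linarith, hR₁.le⟩ (abs_le.1 h)
    simp only [Polynomial.eval_sub, Polynomial.eval_X, hp.eval_zero, sub_zero] at this
    have h2 : η * |x| ≤ η * T := by gcongr; exact abs_le.2 hx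
    have h3 : 0 ≤ 2 * T * (x / R₁) ^ (2 * m) := by positivity
    linarith
  · have h1 := one_le_div_pow hR₁ m h
    have h2 : |p.eval x - x| ≤ 2 * T := by
      have := hp.abs_eval_le x hx
      have h3 : |x| ≤ T := abs_le.2 hx
      have := abs_sub (p.eval x) x
      linarith
    nlinarith [mul_nonneg hη hT.le]

/-- If both points are inside, the divided difference is at least `1 - η`; otherwise it is at least
`c` and one of the two weights is at least `1`. -/
theorem le_log_divDiff (hp : Compresses p R₁ R T c η) (hR₁ : 0 < R₁) (hc : 0 < c)
    (hc1 : c ≤ 1) (hη : 0 ≤ η) (hη2 : η ≤ 1 / 2) (m : ℕ) {x y : ℝ} (hx : x ∈ Set.Icc (-T) T)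
    (hy : y ∈ Set.Icc (-T) T) :
    -(2 * η) + Real.log c * ((x / R₁) ^ (2 * m) + (y / R₁) ^ (2 * m)) ≤
      Real.log (divDiff p x y) := by
  have hwx := div_pow_nonneg (R₁ := R₁) x m
  have hwy := div_pow_nonneg (R₁ := R₁) y m
  have hlc : Real.log c ≤ 0 := Real.log_nonpos hc.le hc1
  by_cases h : |x| ≤ R₁ ∧ |y| ≤ R₁
  · obtain ⟨z, hz, e⟩ := exists_divDiff_eq p (s := Set.Icc (-R₁) R₁) Set.ordConnected_Icc
      (abs_le.1 h.1) (abs_le.1 h.2)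
    have h1 := (abs_le.1 (hp.abs_deriv_sub_one_le z hz)).1
    rw [← e] at h1
    have h2 : 1 - η ≤ divDiff p x y := by linarith
    have h3 : 0 < 1 - η := by linarith
    have h4 := Real.log_le_log h3 h2
    -- `log(1 - η) ≥ 1 - 1/(1 - η) ≥ -2η`, the last step using `η ≤ 1/2`.
    have h5 := Real.one_sub_inv_le_log_of_pos h3
    have h6 : (1 - η)⁻¹ ≤ 1 + 2 * η := by
      rw [inv_le_iff_one_le_mul₀ h3]; nlinarith
    nlinarith [mul_nonneg (neg_nonneg.2 hlc) (add_nonneg hwx hwy)]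
  · have h1 : 1 ≤ (x / R₁) ^ (2 * m) + (y / R₁) ^ (2 * m) := by
      rcases not_and_or.1 h with h | h
      · linarith [one_le_div_pow hR₁ m (not_le.1 h).le]
      · linarith [one_le_div_pow hR₁ m (not_le.1 h).le]
    have h2 := Real.log_le_log hc (hp.le_divDiff hx hy)
    nlinarith

theorem abs_log_divDiff_le (hp : Compresses p R₁ R T c η) (hc : 0 < c) (hc1 : c ≤ 1)
    {x y : ℝ} (hx : x ∈ Set.Icc (-T) T) (hy : y ∈ Set.Icc (-T) T) :
    |Real.log (divDiff p x y)| ≤ Real.log 2 - Real.log c := by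
  have h1 := Real.log_le_log hc (hp.le_divDiff hx hy)
  have h2 := Real.log_le_log (hc.trans_le (hp.le_divDiff hx hy)) (hp.divDiff_le hx hy)
  have h3 : Real.log c ≤ 0 := Real.log_nonpos hc.le hc1
  have h4 : 0 ≤ Real.log 2 := Real.log_nonneg (by norm_num)
  exact abs_le.2 ⟨by linarith, by linarith⟩

end Compresses

/-! ### Effect of a compression on entropies and moments -/

theorem trace_mul_unitary_conj_diagonal {N : ℕ} (U : unitary (Matrix (Fin N) (Fin N) ℂ))
    (B : Matrix (Fin N) (Fin N) ℂ) (d : Fin N → ℝ) :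
    (B * (U * Matrix.diagonal (fun i => (d i : ℂ)) * star (U : Matrix (Fin N) (Fin N) ℂ))).trace =
      ∑ i, (star (U : Matrix (Fin N) (Fin N) ℂ) * B * U) i i * d i := by
  rw [← mul_assoc, Matrix.trace_mul_comm, ← mul_assoc, ← mul_assoc]
  simp [Matrix.trace, Matrix.mul_diagonal]

theorem trace_unitary_conj_diagonal {N : ℕ} (U : unitary (Matrix (Fin N) (Fin N) ℂ))
    (d : Fin N → ℝ) :
    (U * Matrix.diagonal (fun i => (d i : ℂ)) *
      star (U : Matrix (Fin N) (Fin N) ℂ)).trace = ∑ i, (d i : ℂ) := by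
  rw [← one_mul (_ * star (U : Matrix (Fin N) (Fin N) ℂ)), trace_mul_unitary_conj_diagonal,
    mul_one, Unitary.coe_star_mul_self]
  simp

/-- Duality of operator and trace norms. `p(M) - M` need not be small in operator norm, only in
trace norm on average. -/
theorem norm_trace_mul_unitary_conj_diagonal_le {N : ℕ}
    (U : unitary (Matrix (Fin N) (Fin N) ℂ)) (B : Matrix (Fin N) (Fin N) ℂ) (d : Fin N → ℝ) :
    ‖(B * (U * Matrix.diagonal (fun i => (d i : ℂ)) *
      star (U : Matrix (Fin N) (Fin N) ℂ))).trace‖ ≤ ‖B‖ * ∑ i, |d i| := by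
  rw [trace_mul_unitary_conj_diagonal, Finset.mul_sum]
  refine norm_sum_le_of_le _ fun i _ => ?_
  rw [norm_mul, Complex.norm_real, Real.norm_eq_abs]
  gcongr
  refine (norm_matrix_apply_le _ _ _).trans_eq ?_
  rw [CStarRing.norm_mul_coe_unitary, ← Unitary.coe_star, CStarRing.norm_coe_unitary_mul]

theorem matrixState_X_pow {n N : ℕ} {M : Fin n → Herm N} {k : Fin n}
    {U : unitary (Matrix (Fin N) (Fin N) ℂ)} {l : Fin N → ℝ}
    (hM : (M k : Matrix (Fin N) (Fin N) ℂ) =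
      U * Matrix.diagonal (fun i => (l i : ℂ)) * star (U : Matrix (Fin N) (Fin N) ℂ)) (j : ℕ) :
    matrixState M (X k ^ j) = ((1 / N * ∑ i, l i ^ j : ℝ) : ℂ) := by
  have h := aeval_unitary_conj_diagonal U l (Polynomial.X ^ j)
  rw [map_pow, Polynomial.aeval_X] at h
  rw [matrixState, map_pow, evalAt_X, hM, h, trace_unitary_conj_diagonal U fun i =>
    (Polynomial.X ^ j).eval (l i)]
  simp

/-- Turns the eigenvalue weights into moments, which are affine in the measure after integration. -/
theorem sum_div_pow_eq {n N : ℕ} [NeZero N] {M : Fin n → Herm N} {k : Fin n}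
    {U : unitary (Matrix (Fin N) (Fin N) ℂ)} {l : Fin N → ℝ}
    (hM : (M k : Matrix (Fin N) (Fin N) ℂ) =
      U * Matrix.diagonal (fun i => (l i : ℂ)) * star (U : Matrix (Fin N) (Fin N) ℂ)) (R₁ : ℝ)
    (j : ℕ) : ∑ i, (l i / R₁) ^ j = N * ((matrixState M (X k ^ j)).re / R₁ ^ j) := by
  have hN : (N : ℝ) ≠ 0 := NeZero.ne _
  rw [matrixState_X_pow hM, Complex.ofReal_re]
  simp only [div_pow]
  rw [← Finset.sum_div]
  field_simp

/-- Telescoping: letters are replaced one at a time, each costing one trace-norm distance. The free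
factor `B` absorbs the prefix already replaced. -/
theorem norm_trace_mul_lift_sub_le {n N : ℕ} [NeZero N] {A A' : Fin n → Matrix (Fin N) (Fin N) ℂ}
    {S : ℝ} {d : Fin n → ℝ} (hS : 1 ≤ S) (hA : ∀ k, ‖A k‖ ≤ S) (hA' : ∀ k, ‖A' k‖ ≤ S)
    (hd : ∀ k B, ‖(B * (A' k - A k)).trace‖ ≤ ‖B‖ * d k) (hd0 : ∀ k, 0 ≤ d k)
    (w : FreeMonoid (Fin n)) (B : Matrix (Fin N) (Fin N) ℂ) :
    ‖(B * FreeMonoid.lift A' w).trace - (B * FreeMonoid.lift A w).trace‖ ≤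
      ‖B‖ * (S ^ w.length * (w.length * ∑ k, d k)) := by
  induction w using FreeMonoid.inductionOn' generalizing B with
  | one => simp
  | of_mul x xs ih =>
    have hD : 0 ≤ ∑ k, d k := Finset.sum_nonneg fun k _ => hd0 k
    have hdx : d x ≤ ∑ k, d k := Finset.single_le_sum (fun k _ => hd0 k) (Finset.mem_univ x)
    have h1 := ih (B * A' x)
    have h2 := hd x (FreeMonoid.lift A xs * B)
    have h3 : ‖B * A' x‖ ≤ ‖B‖ * S := (norm_mul_le _ _).trans (by gcongr; exact hA' x)
    have h4 : ‖FreeMonoid.lift A xs * B‖ ≤ S ^ xs.length * ‖B‖ :=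
      (norm_mul_le _ _).trans (by gcongr; exact norm_lift_le hA xs)
    -- Cyclicity of the trace moves the suffix to the left, isolating the changed letter.
    have e : (B * FreeMonoid.lift A' (FreeMonoid.of x * xs)).trace -
        (B * FreeMonoid.lift A (FreeMonoid.of x * xs)).trace =
        ((B * A' x * FreeMonoid.lift A' xs).trace - (B * A' x * FreeMonoid.lift A xs).trace) +
          (FreeMonoid.lift A xs * B * (A' x - A x)).trace := by
      rw [map_mul, map_mul, FreeMonoid.lift_eval_of, FreeMonoid.lift_eval_of,
        mul_assoc (FreeMonoid.lift A xs), Matrix.trace_mul_comm (FreeMonoid.lift A xs), mul_sub,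
        sub_mul, Matrix.trace_sub, ← mul_assoc, ← mul_assoc]
      ring
    have hpow : S ^ xs.length ≤ S ^ (xs.length + 1) := pow_le_pow_right₀ hS (Nat.le_succ _)
    have hS0 : 0 ≤ S := by linarith
    rw [e, FreeMonoid.length_mul, FreeMonoid.length_of, add_comm 1]
    calc _ ≤ _ := norm_add_le _ _
      _ ≤ ‖B‖ * S * (S ^ xs.length * (xs.length * ∑ k, d k)) +
          S ^ xs.length * ‖B‖ * ∑ k, d k := by
        refine add_le_add (h1.trans ?_) (h2.trans ?_) <;> gcongr
        exact hd0 x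
      _ ≤ ‖B‖ * S * (S ^ xs.length * (xs.length * ∑ k, d k)) +
          S ^ (xs.length + 1) * ‖B‖ * ∑ k, d k := by gcongr
      _ = _ := by push_cast; ring

/-! ### Pointwise control of the Jacobian and of the trace moments -/

namespace Compresses

variable {p : Polynomial ℝ} {R₁ R T c η : ℝ} {n N : ℕ} {M : Fin n → Herm N}

theorem polyJac_pos (hp : Compresses p R₁ R T c η) (hc : 0 < c) (hM : M ∈ hermBall n N T) :
    0 < polyJac p M := by
  choose U l hU hl using fun k => Herm.exists_diagonalization_of_norm_le (hM k)
  rw [polyJac_eq p hU, abs_pos]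
  simp only [Finset.prod_ne_zero_iff]
  exact fun k _ i _ j _ => (hc.trans_le (hp.le_divDiff (hl k i) (hl k j))).ne'

theorem log_polyJac_eq (hp : Compresses p R₁ R T c η) (hc : 0 < c)
    {U : Fin n → unitary (Matrix (Fin N) (Fin N) ℂ)} {l : Fin n → Fin N → ℝ}
    (hU : ∀ k, (M k : Matrix (Fin N) (Fin N) ℂ) =
      U k * Matrix.diagonal (fun i => (l k i : ℂ)) * star (U k : Matrix (Fin N) (Fin N) ℂ))
    (hl : ∀ k i, l k i ∈ Set.Icc (-T) T) :
    Real.log (polyJac p M) = ∑ k, ∑ i, ∑ j, Real.log (divDiff p (l k i) (l k j)) := by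
  have h0 : ∀ k i j, divDiff p (l k i) (l k j) ≠ 0 := fun k i j =>
    (hc.trans_le (hp.le_divDiff (hl k i) (hl k j))).ne'
  rw [polyJac_eq p hU, Real.log_abs, Real.log_prod fun k _ => by
    simp only [Finset.prod_ne_zero_iff]; exact fun i _ j _ => h0 k i j]
  refine Finset.sum_congr rfl fun k _ => ?_
  rw [Real.log_prod fun i _ => by
    simp only [Finset.prod_ne_zero_iff]; exact fun j _ => h0 k i j]
  exact Finset.sum_congr rfl fun i _ => Real.log_prod fun j _ => h0 k i j

/-- Used only for integrability of the log-Jacobian; the quantitative bound is `le_log_polyJac`. -/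
theorem abs_log_polyJac_le (hp : Compresses p R₁ R T c η) (hc : 0 < c) (hc1 : c ≤ 1)
    (hM : M ∈ hermBall n N T) :
    |Real.log (polyJac p M)| ≤ n * (N * (N * (Real.log 2 - Real.log c))) := by
  choose U l hU hl using fun k => Herm.exists_diagonalization_of_norm_le (hM k)
  rw [hp.log_polyJac_eq hc hU hl]
  have key : ∀ k, |∑ i, ∑ j, Real.log (divDiff p (l k i) (l k j))| ≤
      N * (N * (Real.log 2 - Real.log c)) := fun k => by
    refine (Finset.abs_sum_le_sum_abs _ _).trans ((Finset.sum_le_card_nsmul _ _ _ fun i _ =>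
      (Finset.abs_sum_le_sum_abs _ _).trans (Finset.sum_le_card_nsmul _ _ _ fun j _ =>
        hp.abs_log_divDiff_le hc hc1 (hl k i) (hl k j))).trans_eq (by simp))
  exact (Finset.abs_sum_le_sum_abs _ _).trans ((Finset.sum_le_card_nsmul _ _ _ fun k _ =>
    key k).trans_eq (by simp))

/-- Summing `le_log_divDiff` over the `N²` pairs counts each weight `2N` times, leaving a bound
affine in the moments of `M`. -/
theorem le_log_polyJac [NeZero N] (hp : Compresses p R₁ R T c η) (hR₁ : 0 < R₁) (hc : 0 < c)
    (hc1 : c ≤ 1) (hη : 0 ≤ η) (hη2 : η ≤ 1 / 2) (m : ℕ) (hM : M ∈ hermBall n N T) :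
    ∑ k, (N : ℝ) ^ 2 * (-(2 * η) +
      2 * Real.log c * ((matrixState M (X k ^ (2 * m))).re / R₁ ^ (2 * m))) ≤
      Real.log (polyJac p M) := by
  choose U l hU hl using fun k => Herm.exists_diagonalization_of_norm_le (hM k)
  rw [hp.log_polyJac_eq hc hU hl]
  refine Finset.sum_le_sum fun k _ => ?_
  have h : ∑ i, ∑ j, (-(2 * η) + Real.log c *
      ((l k i / R₁) ^ (2 * m) + (l k j / R₁) ^ (2 * m))) ≤
      ∑ i, ∑ j, Real.log (divDiff p (l k i) (l k j)) :=
    Finset.sum_le_sum fun i _ => Finset.sum_le_sum fun j _ =>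
      hp.le_log_divDiff hR₁ hc hc1 hη hη2 m (hl k i) (hl k j)
  refine le_trans (le_of_eq ?_) h
  have e := sum_div_pow_eq (hU k) R₁ (2 * m)
  simp only [Finset.sum_add_distrib, mul_add, ← Finset.mul_sum, Finset.sum_const,
    Finset.card_univ, Fintype.card_fin, nsmul_eq_mul, e]
  ring

theorem norm_matrixState_sub_le [NeZero N] (hp : Compresses p R₁ R T c η) (hR₁ : 0 < R₁)
    (hR₁T : R₁ ≤ T) (hR : 0 ≤ R) (hRT : R ≤ T) (hη : 0 ≤ η) {S : ℝ} (hS : 1 ≤ S) (hTS : T ≤ S)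
    (m : ℕ) (hM : M ∈ hermBall n N T) (w : FreeMonoid (Fin n)) :
    ‖matrixState (polyTuple p M) (mono w) - matrixState M (mono w)‖ ≤
      S ^ w.length * (w.length * ∑ k, (η * T + 2 * T *
        ((matrixState M (X k ^ (2 * m))).re / R₁ ^ (2 * m)))) := by
  choose U l hU hl using fun k => Herm.exists_diagonalization_of_norm_le (hM k)
  have hN : (0 : ℝ) < N := Nat.cast_pos.2 (NeZero.pos N)
  have hM' : polyTuple p M ∈ hermBall n N R := polyTuple_mem_hermBall hR hp.abs_eval_le hM
  have hdiff : ∀ k, (polyTuple p M k : Matrix (Fin N) (Fin N) ℂ) - M k =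
      U k * Matrix.diagonal (fun i => ((p.eval (l k i) - l k i : ℝ) : ℂ)) *
        star (U k : Matrix (Fin N) (Fin N) ℂ) := fun k => by
    rw [polyTuple, coe_polyHerm, hU k, aeval_unitary_conj_diagonal, ← sub_mul, ← mul_sub,
      Matrix.diagonal_sub]
    simp
  have h := norm_trace_mul_lift_sub_le (A := fun k => (M k : Matrix (Fin N) (Fin N) ℂ))
    (A' := fun k => (polyTuple p M k : Matrix (Fin N) (Fin N) ℂ))
    (d := fun k => ∑ i, |p.eval (l k i) - l k i|) hS (fun k => (hM k).trans hTS)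
    (fun k => (hM' k).trans (hRT.trans hTS))
    (fun k B => by rw [hdiff]; exact norm_trace_mul_unitary_conj_diagonal_le _ _ _)
    (fun k => Finset.sum_nonneg fun i _ => abs_nonneg _) w 1
  rw [one_mul, one_mul, norm_one, one_mul] at h
  have hsum : ∑ k, ∑ i, |p.eval (l k i) - l k i| ≤
      N * ∑ k, (η * T + 2 * T * ((matrixState M (X k ^ (2 * m))).re / R₁ ^ (2 * m))) := by
    rw [Finset.mul_sum]
    refine Finset.sum_le_sum fun k _ => (Finset.sum_le_sum fun i _ =>
      hp.abs_eval_sub_le hR₁ hRT hR₁T hη m (hl k i)).trans_eq ?_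
    have e := sum_div_pow_eq (hU k) R₁ (2 * m)
    simp only [Finset.sum_add_distrib, ← Finset.mul_sum, Finset.sum_const, Finset.card_univ,
      Fintype.card_fin, nsmul_eq_mul, e]
    ring
  rw [matrixState, matrixState, evalAt_mono, evalAt_mono, ← mul_sub, norm_mul, norm_div, norm_one,
    Complex.norm_natCast, one_div, inv_mul_le_iff₀ hN]
  refine h.trans ?_
  have hS0 : 0 ≤ S := by linarith
  calc _ ≤ S ^ w.length * (w.length * (N * ∑ k, (η * T + 2 * T *
        ((matrixState M (X k ^ (2 * m))).re / R₁ ^ (2 * m))))) := by gcongr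
    _ = _ := by ring

end Compresses

theorem integrable_add_mul_re_matrixState {n N : ℕ} [NeZero N] {T : ℝ}
    {μ : Measure (Fin n → Herm N)} (hμ : μ ∈ ballProb n N T) (P : NCPoly n) (a b d : ℝ) :
    Integrable (fun M => a + b * ((matrixState M P).re / d)) μ :=
  have := hμ.1
  (integrable_const a).add (((integrable_matrixState hμ P).re.div_const d).const_mul b)

theorem integral_add_mul_re_matrixState {n N : ℕ} [NeZero N] {T : ℝ}
    {μ : Measure (Fin n → Herm N)} (hμ : μ ∈ ballProb n N T) (P : NCPoly n) (a b d : ℝ) :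
    ∫ M, (a + b * ((matrixState M P).re / d)) ∂μ = a + b * ((barycenter μ P).re / d) := by
  have := hμ.1
  have hi : Integrable (fun M => (matrixState M P).re) μ := (integrable_matrixState hμ P).re
  have e : ∫ M, (matrixState M P).re ∂μ = (barycenter μ P).re :=
    integral_re (integrable_matrixState hμ P)
  rw [integral_add (integrable_const _) ((hi.div_const _).const_mul _), integral_const,
    integral_const_mul, integral_div, e]
  simp

/-! ### Averaging the pointwise bounds over a measure -/

namespace Compresses

variable {p : Polynomial ℝ} {R₁ R T c η : ℝ} {n N : ℕ} {μ : Measure (Fin n → Herm N)}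

theorem map_mem_ballProb (hp : Compresses p R₁ R T c η) (hR : 0 ≤ R) (hμ : μ ∈ ballProb n N T) :
    μ.map (polyTuple p) ∈ ballProb n N R := by
  have := hμ.1
  have hm : Measurable (polyTuple p : (Fin n → Herm N) → _) := (continuous_polyTuple p).measurable
  refine ⟨Measure.isProbabilityMeasure_map hm.aemeasurable, ?_⟩
  rw [Measure.map_apply hm (isClosed_hermBall n N R).measurableSet.compl]
  exact measure_mono_null (Set.compl_subset_compl.2 fun M hM =>
    polyTuple_mem_hermBall hR hp.abs_eval_le hM) hμ.2

theorem classicalEnt_le_map_add [NeZero N] (hp : Compresses p R₁ R T c η) (hR₁ : 0 < R₁)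
    (hc : 0 < c) (hc1 : c ≤ 1) (hη : 0 ≤ η) (hη2 : η ≤ 1 / 2) (hμ : μ ∈ ballProb n N T) {m : ℕ}
    {β : ℝ} (hβ : ∀ k, (barycenter μ (X k ^ (2 * m))).re / R₁ ^ (2 * m) ≤ β) :
    classicalEnt (hermLebesgueTuple n N) μ ≤
      classicalEnt (hermLebesgueTuple n N) (μ.map (polyTuple p)) +
        (((N : ℝ) ^ 2 * (n * (2 * η + 2 * (-Real.log c) * β)) : ℝ) : EReal) := by
  have := hμ.1
  refine classicalEnt_le_classicalEnt_map_add (isClosed_hermBall n N T).measurableSet hμ.2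
    (continuous_polyTuple p).measurable (polyTuple_injOn (hp.injOn hc)) (measurable_polyJac p)
    (fun M hM => hp.polyJac_pos hc hM) (map_withDensity_polyJac (hp.injOn hc))
    (fun M hM => hp.abs_log_polyJac_le hc hc1 hM) ?_
  have hlc : 0 ≤ -Real.log c := neg_nonneg.2 (Real.log_nonpos hc.le hc1)
  have hi : ∀ k, Integrable (fun M => (N : ℝ) ^ 2 * (-(2 * η) +
      2 * Real.log c * ((matrixState M (X k ^ (2 * m))).re / R₁ ^ (2 * m)))) μ := fun k =>
    (integrable_add_mul_re_matrixState hμ _ _ _ _).const_mul _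
  have hi' : Integrable (fun M => Real.log (polyJac p M)) μ :=
    Integrable.of_bound (measurable_polyJac p).log.aestronglyMeasurable _
      (by filter_upwards [ae_mem_hermBall hμ] with M hM using hp.abs_log_polyJac_le hc hc1 hM)
  refine le_trans ?_ (integral_mono_ae (integrable_finsetSum _ fun k _ => hi k) hi' (by
    filter_upwards [ae_mem_hermBall hμ] with M hM
    exact hp.le_log_polyJac hR₁ hc hc1 hη hη2 m hM))
  rw [integral_finsetSum _ fun k _ => hi k]
  have e : -((N : ℝ) ^ 2 * (n * (2 * η + 2 * (-Real.log c) * β))) =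
      ∑ _k : Fin n, (N : ℝ) ^ 2 * (-(2 * η) + 2 * Real.log c * β) := by
    simp; ring
  rw [e]
  refine Finset.sum_le_sum fun k _ => ?_
  rw [integral_const_mul, integral_add_mul_re_matrixState hμ]
  gcongr ?_ * (_ + ?_)
  nlinarith [hβ k]

theorem norm_barycenter_map_sub_le [NeZero N] (hp : Compresses p R₁ R T c η) (hR₁ : 0 < R₁)
    (hR₁T : R₁ ≤ T) (hR : 0 ≤ R) (hRT : R ≤ T) (hη : 0 ≤ η) {S : ℝ} (hS : 1 ≤ S) (hTS : T ≤ S)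
    (hμ : μ ∈ ballProb n N T) {m : ℕ}
    {β : ℝ} (hβ : ∀ k, (barycenter μ (X k ^ (2 * m))).re / R₁ ^ (2 * m) ≤ β)
    (w : FreeMonoid (Fin n)) :
    ‖barycenter (μ.map (polyTuple p)) (mono w) - barycenter μ (mono w)‖ ≤
      S ^ w.length * (w.length * (n * (η * T + 2 * T * β))) := by
  have := hμ.1
  have hT : 0 ≤ T := hR.trans hRT
  have hS0 : 0 ≤ S := by linarith
  have hm : Measurable (polyTuple p : (Fin n → Herm N) → _) := (continuous_polyTuple p).measurable
  have hi1 := integrable_matrixState (hp.map_mem_ballProb hR hμ) (mono w)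
  have hi2 : Integrable (fun M => matrixState (polyTuple p M) (mono w)) μ :=
    (integrable_map_measure hi1.aestronglyMeasurable hm.aemeasurable).1 hi1
  rw [barycenter, barycenter, integral_map hm.aemeasurable hi1.aestronglyMeasurable,
    ← integral_sub hi2 (integrable_matrixState hμ _)]
  have hi : ∀ k, Integrable (fun M => η * T + 2 * T *
      ((matrixState M (X k ^ (2 * m))).re / R₁ ^ (2 * m))) μ := fun k =>
    integrable_add_mul_re_matrixState hμ _ _ _ _
  refine (norm_integral_le_of_norm_le (((integrable_finsetSum Finset.univ fun k _ =>
    hi k).const_mul _).const_mul _) (by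
      filter_upwards [ae_mem_hermBall hμ] with M hM
      exact hp.norm_matrixState_sub_le hR₁ hR₁T hR hRT hη hS hTS m hM w)).trans ?_
  rw [integral_const_mul, integral_const_mul, integral_finsetSum _ fun k _ => hi k]
  have e : (n : ℝ) * (η * T + 2 * T * β) = ∑ _k : Fin n, (η * T + 2 * T * β) := by simp [mul_add]
  rw [e]
  gcongr with k
  rw [integral_add_mul_re_matrixState hμ]
  gcongr
  exact hβ k

end Compresses

/-! ### Comparison of cutoffs -/

theorem MomentBound.mono {n : ℕ} {τ : NCPoly n →ₗ[ℂ] ℂ} {P : NCPoly n} {r s : ℝ}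
    (h : MomentBound τ P r) (hr : 0 ≤ r) (hrs : r ≤ s) : MomentBound τ P s :=
  fun k => (h k).trans (pow_le_pow_left₀ hr hrs _)

theorem traceStates_mono {n : ℕ} {R T : ℝ} (h : R ≤ T) : traceStates n R ⊆ traceStates n T :=
  fun _ hτ => ⟨hτ.1, hτ.2.1.trans h, fun i => (hτ.2.2 i).mono hτ.2.1 h⟩

/-- Nonemptiness of the set whose infimum is `stateRadius`, without which `sInf` is a default value.
-/
theorem IsTraceState.exists_mem_traceStates {n : ℕ} {τ : NCPoly n →ₗ[ℂ] ℂ} (hτ : IsTraceState τ) :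
    ∃ R, τ ∈ traceStates n R := by
  choose r hr h using fun i : Fin n => hτ.bounded (X i)
  exact ⟨∑ i, r i, hτ, Finset.sum_nonneg fun i _ => (hr i).le, fun i => (h i).mono (hr i).le
    (Finset.single_le_sum (fun j _ => (hr j).le) (Finset.mem_univ i))⟩

theorem IsTraceState.exists_mem_traceStates_lt {n : ℕ} {τ : NCPoly n →ₗ[ℂ] ℂ}
    (hτ : IsTraceState τ) {R : ℝ} (hR : stateRadius τ < R) : ∃ R₀ < R, τ ∈ traceStates n R₀ := by
  obtain ⟨R₀, h, h'⟩ := exists_lt_of_csInf_lt hτ.exists_mem_traceStates hR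
  exact ⟨R₀, h', h⟩

theorem normalizedRho_mono_radius {n : ℕ} {R T : ℝ} (h : R ≤ T) (τ : NCPoly n →ₗ[ℂ] ℂ) (K : ℕ)
    (ε : ℝ) (N : ℕ) : normalizedRho R τ K ε N ≤ normalizedRho T τ K ε N := by
  unfold normalizedRho
  have h0 : (0 : EReal) ≤ ((1 / (N : ℝ) ^ 2 : ℝ) : EReal) := EReal.coe_nonneg.2 (by positivity)
  have hball : hermBall n N R ⊆ hermBall n N T := fun M hM i => (hM i).trans h
  refine add_le_add_left (mul_le_mul_of_nonneg_left ?_ h0) _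
  refine iSup₂_le fun σ hσ => le_trans ?_ (le_iSup₂_of_le (f := fun σ _ => rho T N K σ) σ
    ⟨traceStates_mono h hσ.1, hσ.2⟩ le_rfl)
  exact biSup_mono fun μ hμ => ⟨⟨hμ.1.1, measure_mono_null (Set.compl_subset_compl.2 hball) hμ.1.2⟩,
    hμ.2⟩

theorem X_pow_eq_mono {n : ℕ} (k : Fin n) (j : ℕ) : X k ^ j = mono (FreeMonoid.of k ^ j) := by
  rw [X, mono, mono, map_pow]

theorem length_of_pow {n : ℕ} (k : Fin n) (j : ℕ) : (FreeMonoid.of k ^ j).length = j := by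
  induction j with
  | zero => simp
  | succ j ih => rw [pow_succ, FreeMonoid.length_mul, ih, FreeMonoid.length_of]

theorem re_apply_X_pow_le {n : ℕ} {τ : NCPoly n →ₗ[ℂ] ℂ} {R : ℝ} (hτ : τ ∈ traceStates n R)
    (k : Fin n) (m : ℕ) : (τ (X k ^ (2 * m))).re ≤ R ^ (2 * m) := by
  have := hτ.2.2 k m
  rwa [adj_X, ← pow_two, ← pow_mul] at this

/-- Monomials of `μ` close to those of a state of radius `< R` allow to push `μ` into the ball of
radius `R` without changing low moments or entropy much. -/
theorem exists_ballProb_classicalEnt_le {n : ℕ} {τ : NCPoly n →ₗ[ℂ] ℂ} {R₀ R T : ℝ}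
    (hτ : τ ∈ traceStates n R₀) (hR : R₀ < R) (hT : R < T) (K : ℕ) {ε δ : ℝ} (hε : 0 < ε)
    (hδ : 0 < δ) :
    ∃ (K' : ℕ) (ε' : ℝ), 0 < ε' ∧ ∀ (N : ℕ) [NeZero N] (μ : Measure (Fin n → Herm N)),
      μ ∈ ballProb n N T →
      (∀ w : FreeMonoid (Fin n), w.length < K' → ‖τ (mono w) - barycenter μ (mono w)‖ < ε') →
      ∃ ν ∈ ballProb n N R,
        (∀ w : FreeMonoid (Fin n), w.length < K → ‖τ (mono w) - barycenter ν (mono w)‖ < ε) ∧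
        classicalEnt (hermLebesgueTuple n N) μ ≤
          classicalEnt (hermLebesgueTuple n N) ν + (((N : ℝ) ^ 2 * δ : ℝ) : EReal) := by
  have hR₀ : 0 ≤ R₀ := hτ.2.1
  -- The strict gap `R₀ < R₁` makes `(R₀ / R₁)^(2m)` tend to `0`.
  obtain ⟨R₁, h01, h1⟩ := exists_between hR
  have hR₁ : 0 < R₁ := hR₀.trans_lt h01
  have hR0 : 0 < R := hR₁.trans h1
  have hT0 : 0 < T := hR0.trans hT
  obtain ⟨c, hc, hc1, hp⟩ := exists_compressing_polynomial hR₁.le h1 hT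
  have hlc : 0 ≤ -Real.log c := neg_nonneg.2 (Real.log_nonpos hc.le hc1)
  set S := max T 1 with hS
  have hS1 : 1 ≤ S := le_max_right _ _
  have hTS : T ≤ S := le_max_left _ _
  set A : ℝ := n * (2 + 2 * (-Real.log c)) with hA
  have hA0 : 0 ≤ A := by positivity
  set B : ℝ := S ^ K * (K * (n * (3 * T))) with hB
  have hB0 : 0 ≤ B := by positivity
  -- `κ` serves both as `η` and as the bound on the rescaled moments; `A` involves `log c`, already
  -- fixed. The `+ 1` in the denominators avoids division by zero.
  obtain ⟨κ, hκ, hκ2, hκA, hκB⟩ : ∃ κ > 0, κ ≤ 1 / 2 ∧ κ * A ≤ δ ∧ κ * B < ε / 2 := by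
    refine ⟨min (1 / 2) (min (δ / (A + 1)) (ε / 2 / (B + 1))), by positivity, min_le_left _ _,
      ?_, ?_⟩
    · calc _ ≤ δ / (A + 1) * A := by
            gcongr; exact (min_le_right _ _).trans (min_le_left _ _)
        _ ≤ δ := by rw [div_mul_eq_mul_div, div_le_iff₀ (by positivity)]; nlinarith
    · calc _ ≤ ε / 2 / (B + 1) * B := by
            gcongr; exact (min_le_right _ _).trans (min_le_right _ _)
        _ < ε / 2 := by rw [div_mul_eq_mul_div, div_lt_iff₀ (by positivity)]; nlinarith
  obtain ⟨p, hp⟩ := hp κ hκ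
  obtain ⟨m, hm⟩ : ∃ m : ℕ, (R₀ / R₁) ^ (2 * m) ≤ κ / 2 := by
    obtain ⟨m, hm⟩ := exists_pow_lt_of_lt_one (half_pos hκ) ((div_lt_one hR₁).2 h01)
    exact ⟨m, (pow_le_pow_of_le_one (by positivity) ((div_lt_one hR₁).2 h01).le
      (by omega)).trans hm.le⟩
  -- Degrees are strictly below the cutoff, so `2m + 1` is needed to see `X_k^(2m)`. The second
  -- tolerance makes the rescaled moment at most `κ / 2 + κ / 2`.
  refine ⟨max K (2 * m + 1), min (ε / 2) (κ / 2 * R₁ ^ (2 * m)), by positivity,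
    fun N _ μ hμ hclose => ?_⟩
  have hβ : ∀ k, (barycenter μ (X k ^ (2 * m))).re / R₁ ^ (2 * m) ≤ κ := fun k => by
    have h := hclose (FreeMonoid.of k ^ (2 * m)) (by rw [length_of_pow]; omega)
    rw [← X_pow_eq_mono] at h
    have h2 := (abs_le.1 (Complex.abs_re_le_norm (τ (X k ^ (2 * m)) -
      barycenter μ (X k ^ (2 * m))))).1
    have h3 := h.trans_le (min_le_right _ _)
    have h4 := re_apply_X_pow_le hτ k m
    rw [Complex.sub_re] at h2
    rw [div_pow, div_le_iff₀ (by positivity)] at hm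
    rw [div_le_iff₀ (by positivity)]
    linarith
  refine ⟨μ.map (polyTuple p), hp.map_mem_ballProb hR0.le hμ, fun w hw => ?_, ?_⟩
  · have h5 := (hclose w (hw.trans_le (le_max_left _ _))).trans_le (min_le_left _ _)
    have h2 := hp.norm_barycenter_map_sub_le hR₁ (h1.trans hT).le hR0.le hT.le hκ.le hS1 hTS hμ hβ w
    have h3 : S ^ w.length * (w.length * (n * (κ * T + 2 * T * κ))) ≤ κ * B := by
      have : κ * B = S ^ K * (K * (n * (κ * T + 2 * T * κ))) := by rw [hB]; ring
      rw [this]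
      gcongr
    rw [norm_sub_rev] at h2
    have h4 := norm_sub_le_norm_sub_add_norm_sub (τ (mono w)) (barycenter μ (mono w))
      (barycenter (μ.map (polyTuple p)) (mono w))
    linarith
  · refine (hp.classicalEnt_le_map_add hR₁ hc hc1 hκ.le hκ2 hμ hβ).trans ?_
    refine add_le_add_right (EReal.coe_le_coe_iff.2 ?_) _
    gcongr
    refine le_trans (le_of_eq ?_) hκA
    rw [hA]; ring

theorem exists_normalizedRho_le {n : ℕ} {τ : NCPoly n →ₗ[ℂ] ℂ} (hτ : IsTraceState τ) {R T : ℝ}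
    (hR : stateRadius τ < R) (hT : R < T) (K : ℕ) {ε δ : ℝ} (hε : 0 < ε) (hδ : 0 < δ) :
    ∃ (K' : ℕ) (ε' : ℝ), 0 < ε' ∧ ∀ N : ℕ, N ≠ 0 →
      normalizedRho T τ K' ε' N ≤ normalizedRho R τ K ε N + (δ : EReal) := by
  obtain ⟨R₀, hR₀R, hτ₀⟩ := hτ.exists_mem_traceStates_lt hR
  have hR0 : 0 ≤ R := hτ₀.2.1.trans hR₀R.le
  obtain ⟨K', ε', hε', h⟩ := exists_ballProb_classicalEnt_le hτ₀ hR₀R hT K hε hδ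
  refine ⟨K', ε', hε', fun N hN => ?_⟩
  have : NeZero N := ⟨hN⟩
  have hN' : (N : ℝ) ≠ 0 := Nat.cast_ne_zero.2 hN
  have hsup : (⨆ σ ∈ stateNhd T ε' K' τ, rho T N K' σ) ≤
      (⨆ σ ∈ stateNhd R ε K τ, rho R N K σ) + (((N : ℝ) ^ 2 * δ : ℝ) : EReal) := by
    refine iSup₂_le fun σ hσ => iSup₂_le fun μ hμ => ?_
    obtain ⟨ν, hν, hν', hent⟩ := h N μ hμ.1 fun w hw => by rw [hμ.2 w hw]; exact hσ.2 w hw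
    refine hent.trans (add_le_add_left ?_ _)
    -- Taking as state the barycenter of `ν` makes the moment constraint in `rho` hold by
    -- definition.
    refine le_iSup₂_of_le (barycenterState hν)
      ⟨barycenterState_mem_traceStates hR0 hν, fun w hw => hν' w hw⟩ ?_
    exact le_iSup₂_of_le (f := fun μ _ => classicalEnt (hermLebesgueTuple n N) μ) ν
      ⟨hν, fun w _ => rfl⟩ le_rfl
  have h0 : (0 : EReal) ≤ ((1 / (N : ℝ) ^ 2 : ℝ) : EReal) := EReal.coe_nonneg.2 (by positivity)
  unfold normalizedRho
  refine (add_le_add_left (mul_le_mul_of_nonneg_left hsup h0) _).trans_eq ?_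
  rw [EReal.left_distrib_of_nonneg_of_ne_top h0 (EReal.coe_ne_top _), ← EReal.coe_mul,
    show 1 / (N : ℝ) ^ 2 * ((N : ℝ) ^ 2 * δ) = δ by field_simp, add_right_comm]

/-! ### Passage to the limit in the extended reals -/

theorem EReal.le_of_forall_pos_le_add_coe {a b : EReal} (h : ∀ δ : ℝ, 0 < δ → a ≤ b + δ) :
    a ≤ b := by
  refine EReal.le_of_forall_lt_iff_le.1 fun z hz => ?_
  induction b with
  | bot => simpa using (h 1 one_pos).trans bot_le
  | top => exact absurd hz (by simp)
  | coe b =>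
    have := h (z - b) (_root_.sub_pos.2 (EReal.coe_lt_coe_iff.1 hz))
    rwa [← EReal.coe_add, add_sub_cancel] at this

theorem EReal.monotone_add_coe (δ : ℝ) : Monotone fun x : EReal => x + δ :=
  fun _ _ h => add_le_add_left h _

/-- A real summand avoids the discontinuities of addition at `(⊥, ⊤)` and `(⊤, ⊥)`; with
monotonicity, the shift commutes with `liminf` and `limsup`. -/
theorem EReal.continuous_add_coe (δ : ℝ) : Continuous fun x : EReal => x + δ :=
  continuous_iff_continuousAt.2 fun x =>
    (EReal.continuousAt_add (p := (x, (δ : EReal))) (by simp) (by simp)).comp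
      (f := fun x : EReal => (x, (δ : EReal))) (by fun_prop)

theorem EReal.liminf_le_liminf_add_coe {u v : ℕ → EReal} {δ : ℝ}
    (h : ∀ᶠ N in atTop, u N ≤ v N + δ) : liminf u atTop ≤ liminf v atTop + δ :=
  (liminf_le_liminf h).trans_eq ((EReal.monotone_add_coe δ).map_liminf_of_continuousAt v
    (EReal.continuous_add_coe δ).continuousAt).symm

theorem EReal.limsup_le_limsup_add_coe {u v : ℕ → EReal} {δ : ℝ}
    (h : ∀ᶠ N in atTop, u N ≤ v N + δ) : limsup u atTop ≤ limsup v atTop + δ :=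
  (limsup_le_limsup h).trans_eq ((EReal.monotone_add_coe δ).map_limsup_of_continuousAt v
    (EReal.continuous_add_coe δ).continuousAt).symm

theorem EReal.limUnder_ultrafilter_le_add_coe {ω : Ultrafilter ℕ}
    (hω : (ω : Filter ℕ) ≤ cofinite) {u v : ℕ → EReal} {δ : ℝ}
    (h : ∀ᶠ N in atTop, u N ≤ v N + δ) :
    limUnder (ω : Filter ℕ) u ≤ limUnder (ω : Filter ℕ) v + δ := by
  rw [Nat.cofinite_eq_atTop] at hω
  exact le_of_tendsto_of_tendsto (tendsto_ultrafilter ω u)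
    (((EReal.continuous_add_coe δ).tendsto _).comp (tendsto_ultrafilter ω v)) (hω h)

/-- The comparison of cutoffs for any notion of limit `Λ` as `N → ∞`. -/
theorem iInf_normalizedRho_le {n : ℕ} {τ : NCPoly n →ₗ[ℂ] ℂ} (hτ : IsTraceState τ) {R T : ℝ}
    (hR : stateRadius τ < R) (hT : R < T) (Λ : (ℕ → EReal) → EReal)
    (hΛ : ∀ {u v : ℕ → EReal} {δ : ℝ}, (∀ᶠ N in atTop, u N ≤ v N + δ) → Λ u ≤ Λ v + δ) :
    (⨅ (K : ℕ) (ε : ℝ) (_ : 0 < ε), Λ (normalizedRho T τ K ε)) ≤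
      ⨅ (K : ℕ) (ε : ℝ) (_ : 0 < ε), Λ (normalizedRho R τ K ε) := by
  refine le_iInf fun K => le_iInf₂ fun ε hε => EReal.le_of_forall_pos_le_add_coe fun δ hδ => ?_
  obtain ⟨K', ε', hε', h⟩ := exists_normalizedRho_le hτ hR hT K hε hδ
  exact (iInf_le_of_le K' (iInf₂_le ε' hε')).trans
    (hΛ ((eventually_ne_atTop 0).mono h))

theorem iInf_normalizedRho_mono {n : ℕ} (τ : NCPoly n →ₗ[ℂ] ℂ) {R T : ℝ}
    (hT : R ≤ T) (Λ : (ℕ → EReal) → EReal)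
    (hΛ : ∀ {u v : ℕ → EReal} {δ : ℝ}, (∀ᶠ N in atTop, u N ≤ v N + δ) → Λ u ≤ Λ v + δ) :
    (⨅ (K : ℕ) (ε : ℝ) (_ : 0 < ε), Λ (normalizedRho R τ K ε)) ≤
      ⨅ (K : ℕ) (ε : ℝ) (_ : 0 < ε), Λ (normalizedRho T τ K ε) := by
  refine iInf_mono fun K => iInf₂_mono fun ε _ => ?_
  simpa using hΛ (δ := 0) (Eventually.of_forall fun N => by
    simpa using normalizedRho_mono_radius hT τ K ε N)

theorem cutoff_independence {n : ℕ} {τ : NCPoly n →ₗ[ℂ] ℂ} (hτ : IsTraceState τ)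
    {χ : ℝ → EReal} (Λ : (ℕ → EReal) → EReal)
    (hχ : ∀ R, χ R = ⨅ (K : ℕ) (ε : ℝ) (_ : 0 < ε), Λ (normalizedRho R τ K ε))
    (hΛ : ∀ {u v : ℕ → EReal} {δ : ℝ}, (∀ᶠ N in atTop, u N ≤ v N + δ) → Λ u ≤ Λ v + δ)
    {R T : ℝ} (hR : stateRadius τ < R) (hRT : R < T) :
    χ T = χ R ∧ χ R = ⨆ R : ℝ, ⨆ _ : stateRadius τ ≤ R, χ R := by
  have hmono : ∀ {R T : ℝ}, R ≤ T → χ R ≤ χ T := fun h => by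
    rw [hχ, hχ]; exact iInf_normalizedRho_mono τ h Λ hΛ
  have hle : ∀ {T : ℝ}, R < T → χ T ≤ χ R := fun h => by
    rw [hχ, hχ]; exact iInf_normalizedRho_le hτ hR h Λ hΛ
  refine ⟨(hle hRT).antisymm (hmono hRT.le), le_antisymm (le_iSup₂_of_le R hR.le le_rfl)
    (iSup₂_le fun R' _ => ?_)⟩
  -- Each `R'` is compared through one cutoff above it and, thanks to the `1`, strictly above `R`;
  -- this also covers `R' = stateRadius τ`.
  have h1 : R' ≤ max R R' + 1 := by linarith [le_max_right R R']
  have h2 : R < max R R' + 1 := by linarith [le_max_left R R']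
  exact (hmono h1).trans (hle h2)

end

theorem mainTheorem5 (n : ℕ) (hn : 1 ≤ n) (τ : NCPoly n →ₗ[ℂ] ℂ) (hτ : IsTraceState τ)
    (R T : ℝ) (hR : stateRadius τ < R) (hRT : R < T) :
    (chiLiminf T τ = chiLiminf R τ ∧ chiLiminf R τ = chiLiminfSup τ) ∧
    (chiLimsup T τ = chiLimsup R τ ∧ chiLimsup R τ = chiLimsupSup τ) ∧
    (∀ ω : Ultrafilter ℕ, (ω : Filter ℕ) ≤ Filter.cofinite →
      chiUltra ω T τ = chiUltra ω R τ ∧ chiUltra ω R τ = chiUltraSup ω τ) := by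
  exact ⟨cutoff_independence hτ (fun u => liminf u atTop) (fun R => chiLiminf_eq_iInf R τ)
      EReal.liminf_le_liminf_add_coe hR hRT,
    cutoff_independence hτ (fun u => limsup u atTop) (fun R => chiLimsup_eq_iInf R τ)
      EReal.limsup_le_limsup_add_coe hR hRT,
    fun ω hω => cutoff_independence hτ (fun u => limUnder (ω : Filter ℕ) u)
      (fun R => chiUltra_eq_iInf ω R τ) (EReal.limUnder_ultrafilter_le_add_coe hω) hR hRT⟩
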